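/- Let $\ell\ge 4$ and let $(\ell_\mu\ge\dots\ge\ell_1)$ be a partition of $\ell$ with an even number $\mu$ of parts. Let $K$ be the $2\ell\times2\ell$ matrix with ones on the anti-diagonal and zeroes elsewhere, let $G=\mathrm{SO}_{2\ell}(\mathbb C)=\{g : g=(Kg^{-1}K)^T,\ \det g=1\}$, with diagonal torus $A$. Identify $X_*(A)$ with $\mathbb Z^\ell$ by $\lambda(t)=\mathrm{Diag}(t^{\lambda_1},\dots,t^{\lambda_\ell},t^{-\lambda_\ell},\dots,t^{-\lambda_1})$, and $V = X_*(A)\otimes\mathbb R$ with $\mathbb R^\ell$. The simple roots are $\gamma_k=e_k-e_{k+1}$ ($1\le k<\ell$) and $\gamma_\ell=e_{\ell-1}+e_\ell$; let $\check\mu_1,\dots,\check\mu_\ell\in V$ be the dual basis of fundamental coweights, let $\gamma_0=1-(e_1+e_2)$ be the affine simple root, and let $b_{0}=b_{1}=b_{\ell-1}=b_{\ell}=1$ and $b_{k}=2$ for $2\le k\le\ell-2$. Let $C=\{v\in V : 0<\alpha(v)<1 \text{ for all positive roots }\alpha\}$ be the fundamental alcove. A Kac diagram of an element $g\in G$ of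 finite order $m'$, with respect to a primitive $m'$-th root of unity $\xi$, is the labelling of the nodes $\gamma_0,\dots,\gamma_\ell$ of the affine Dynkin diagram obtained as follows: choose $h\in G$ and $\lambda\in X_*(A)$ such that $h^{-1}gh=\lambda(\xi)$ and $\lambda/m'\in\overline{C}$, write $\lambda/m'=\frac1{m'}\sum_{k=1}^{\ell}s_k\check\mu_k$ and $m'=\sum_{k=0}^{\ell}s_kb_k$ with integers $s_k\ge0$, divide all the $s_k$ by their greatest common divisor, and put the resulting integers on the nodes $\gamma_k$. For $1\le k\le\ell$ let $t_k$ be the permutation matrix of the transposition $(k,\,2\ell-k+1)$, for $1\le k<\ell$ let $s_k$ be the permutation matrix of $(k,\,k+1)(2\ell-k,\,2\ell-k+1)$, put $\ell'_\nu=\ell_1+\dots+\ell_{\nu-1}$, and let $$n_{\vec\ell}=\prod_{\nu=1}^{\mu}\bigl(s_{\ell'_\nu+1}s_{\ell'_\nu+2}\cdots s_{\ell'_\nu+\ell_\nu-1}\,t_{\ell'_\nu+\ell_\nu}\bigr)$$ (factors in the order $\nu=1,\dots,\mu$). Put $m=2\,\mathrm{lcm}(\ell_1,\dots,\ell_\mu)$,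 and let $\sigma_1\ge\sigma_2\ge\dots\ge\sigma_\ell$ be the decreasing rearrangement of the list that consists of the numbers $a_\nu m/(2\ell_\nu)$ ($1\le\nu\le\mu$, $1\le a_\nu\le\ell_\nu-1$), $\mu/2$ copies of $m/2$ and $\mu/2$ zeroes. Then $n_{\vec\ell}$ is an element of finite order of $G$ and, for every primitive root of unity $\xi$ whose order is the order of $n_{\vec\ell}$, it has exactly one Kac diagram. Up to division of all labels by their greatest common divisor, this diagram has the label $m-(\sigma_1+\sigma_2)$ on $\gamma_0$, the label $\sigma_k-\sigma_{k+1}$ on $\gamma_k$ for $1\le k\le\ell-1$, and the label $\sigma_{\ell-1}+\sigma_\ell$ on $\gamma_\ell$. (The nodes $\gamma_0,\gamma_1$ form one fork of the diagram, both joined to $\gamma_2$, and $\gamma_{\ell-1},\gamma_\ell$ form the other, both joined to $\gamma_{\ell-2}$.) -/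

import Mathlib

open Matrix

namespace KacD

/-! ### The group `SO_{2ℓ}` and its diagonal torus -/

/-- The square matrix with ones on the anti-diagonal and zeroes elsewhere. -/
def antiDiag (n : ℕ) : Matrix (Fin n) (Fin n) ℂ :=
  Matrix.of fun i j => if j = Fin.rev i then 1 else 0

/-- `SO_{2ℓ}(ℂ)`, realized as the matrices with `g = (K g⁻¹ K)ᵀ` and `det g = 1`. -/
def SO (ℓ : ℕ) : Set (Matrix (Fin (2 * ℓ)) (Fin (2 * ℓ)) ℂ) :=
  {g | g = (antiDiag (2 * ℓ) * g⁻¹ * antiDiag (2 * ℓ))ᵀ ∧ g.det = 1}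

/-- The value at `z` of the cocharacter `lam ∈ ℤ^ℓ = X_*(A)` of the diagonal torus `A`:
`Diag(z^{lam_1}, …, z^{lam_ℓ}, z^{-lam_ℓ}, …, z^{-lam_1})`. -/
noncomputable def cochar {ℓ : ℕ} (lam : Fin ℓ → ℤ) (z : ℂ) :
    Matrix (Fin (2 * ℓ)) (Fin (2 * ℓ)) ℂ :=
  Matrix.diagonal fun i =>
    if h : (i : ℕ) < ℓ then z ^ lam ⟨i, h⟩
    else z ^ (-lam ⟨2 * ℓ - 1 - i, by omega⟩)

/-! ### The root system, the alcove and the fundamental coweights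

`V = X_*(A) ⊗ ℝ` is `ℝ^ℓ`, and roots are paired with it by the dot product. The entry `i : Fin ℓ`
is the coordinate number `i + 1`. -/

/-- The standard basis vector `e_{i+1}` of `ℝ^ℓ`. -/
def e {ℓ : ℕ} (i : Fin ℓ) : Fin ℓ → ℝ := Pi.single i 1

/-- The positive roots `e_i ± e_j` (`i < j`) of `D_ℓ`. -/
def posRoots (ℓ : ℕ) : Set (Fin ℓ → ℝ) :=
  {α | ∃ i j : Fin ℓ, i < j ∧ (α = e i - e j ∨ α = e i + e j)}

/-- The simple roots: `simpleRoot k` is `α_{k+1}`, that is `e_{k+1} - e_{k+2}` if `k + 1 < ℓ`,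
and `e_{ℓ-1} + e_ℓ` if `k + 1 = ℓ`. -/
def simpleRoot {ℓ : ℕ} (k : Fin ℓ) : Fin ℓ → ℝ :=
  if h : (k : ℕ) + 1 < ℓ then e k - e ⟨k + 1, h⟩ else e ⟨k - 1, by omega⟩ + e k

/-- The fundamental alcove `C`: the connected component of the complement of all hyperplanes
`⟨α, v⟩ = n` (`α` a root, `n ∈ ℤ`) which lies in the dominant chamber and has the origin in its
closure. -/
def alcove (ℓ : ℕ) : Set (Fin ℓ → ℝ) :=
  {v | ∀ α ∈ posRoots ℓ, 0 < α ⬝ᵥ v ∧ α ⬝ᵥ v < 1}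

/-- The fundamental coweights: `coweight k` is the coweight dual to the simple root `α_{k+1}`. -/
noncomputable def coweight {ℓ : ℕ} (k : Fin ℓ) : Fin ℓ → ℝ := fun i =>
  if (k : ℕ) + 2 < ℓ then (if i ≤ k then 1 else 0)
  else if (k : ℕ) + 2 = ℓ ∧ (i : ℕ) + 1 = ℓ then -(1 / 2) else 1 / 2

/-- The labels `b_γ` of the affine Dynkin diagram with nodes `γ_0, γ_1, …, γ_ℓ`: they are `1` on
`γ_0, γ_1, γ_{ℓ-1}, γ_ℓ` and `2` on the other nodes. On `γ_1, …, γ_ℓ` these are the coefficients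
of the highest root with respect to the simple roots. -/
def mark {ℓ : ℕ} (k : Fin (ℓ + 1)) : ℕ :=
  if (k : ℕ) ≤ 1 ∨ ℓ ≤ (k : ℕ) + 1 then 1 else 2

theorem simpleRoot_dotProduct_coweight {ℓ : ℕ} (hl : 4 ≤ ℓ) (j k : Fin ℓ) :
    simpleRoot j ⬝ᵥ coweight k = if j = k then 1 else 0 := by
  have hk := k.isLt
  have hj := j.isLt
  unfold simpleRoot
  split_ifs with h1 h2 h2 <;>
    simp only [e, sub_dotProduct, add_dotProduct, single_dotProduct, one_mul, coweight,
      Fin.le_def, Fin.ext_iff] at * <;>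
    split_ifs <;> first | omega | norm_num

theorem highestRoot_dotProduct_coweight {ℓ : ℕ} (hl : 4 ≤ ℓ) (k : Fin ℓ) :
    (e ⟨0, by omega⟩ + e ⟨1, by omega⟩ : Fin ℓ → ℝ) ⬝ᵥ coweight k = mark k.succ := by
  have hk := k.isLt
  simp only [e, add_dotProduct, single_dotProduct, one_mul, coweight, mark,
    Fin.le_def, Fin.val_succ]
  split_ifs <;> first | omega | norm_num

/-! ### Kac diagrams -/

/-- Remove the factors that are common to all labels. -/
def reduce {ℓ : ℕ} (s : Fin (ℓ + 1) → ℤ) : Fin (ℓ + 1) → ℤ :=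
  fun k => s k / Finset.univ.gcd s

/-- `IsKacDiagram ξ g d`: the labelling `d` of the affine Dynkin diagram of type `D_ℓ` (`d k` is
the label of the node `γ_k`) is a Kac diagram of `g ∈ SO_{2ℓ}`. Here `g` has finite order `m`, and
`ξ` is a primitive `m`-th root of unity. There are `h ∈ SO_{2ℓ}` and a cocharacter `lam` of the
torus with `h⁻¹ g h = lam(ξ)`, such that the point `x_g = lam / m` lies in the closure of the
alcove; the nonnegative integers `s_γ` are the coordinates of this point,
`x_g = (1/m) ∑_{γ ≠ γ_0} s_γ μ_γ` and `m = ∑_γ s_γ b_γ`; and `d` is obtained from `s` by removing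
common factors. -/
def IsKacDiagram {ℓ : ℕ} (ξ : ℂ) (g : Matrix (Fin (2 * ℓ)) (Fin (2 * ℓ)) ℂ)
    (d : Fin (ℓ + 1) → ℤ) : Prop :=
  g ∈ SO ℓ ∧ IsOfFinOrder g ∧ IsPrimitiveRoot ξ (orderOf g) ∧
  ∃ h ∈ SO ℓ, ∃ lam : Fin ℓ → ℤ, ∃ x : Fin ℓ → ℝ, ∃ s : Fin (ℓ + 1) → ℤ,
    h⁻¹ * g * h = cochar lam ξ ∧
    (∀ i, x i = (lam i : ℝ) / (orderOf g : ℝ)) ∧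
    x ∈ closure (alcove ℓ) ∧
    (∀ k, 0 ≤ s k) ∧
    x = (1 / (orderOf g : ℝ)) • ∑ k : Fin ℓ, (s k.succ : ℝ) • coweight k ∧
    (orderOf g : ℤ) = ∑ k, s k * (mark k : ℤ) ∧
    d = reduce s

/-! ### The element attached to a partition

Below, `k` and the rows and columns `i + 1`, `j + 1` are counted from `1`. -/

/-- The element `s_k` of `SO_{2ℓ}` (`1 ≤ k < ℓ`). -/
def sMat (ℓ k : ℕ) : Matrix (Fin (2 * ℓ)) (Fin (2 * ℓ)) ℂ :=
  Matrix.of fun i j =>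
    let r : ℕ := i + 1
    let c : ℕ := j + 1
    if (r = c ∧ r ∉ ({k, k + 1, 2 * ℓ - k + 1, 2 * ℓ - k} : Finset ℕ)) ∨
        (r ≠ c ∧ r ∈ ({k, k + 1} : Finset ℕ) ∧ c ∈ ({k, k + 1} : Finset ℕ)) ∨
        (r ≠ c ∧ r ∈ ({2 * ℓ - k, 2 * ℓ - k + 1} : Finset ℕ) ∧
          c ∈ ({2 * ℓ - k, 2 * ℓ - k + 1} : Finset ℕ))
    then 1 else 0

/-- The element `t_k` of `O_{2ℓ}` (`1 ≤ k ≤ ℓ`). -/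
def tMat (ℓ k : ℕ) : Matrix (Fin (2 * ℓ)) (Fin (2 * ℓ)) ℂ :=
  Matrix.of fun i j =>
    let r : ℕ := i + 1
    let c : ℕ := j + 1
    if (r = c ∧ r ∉ ({k, 2 * ℓ - k + 1} : Finset ℕ)) ∨
        (r ≠ c ∧ r ∈ ({k, 2 * ℓ - k + 1} : Finset ℕ) ∧ c ∈ ({k, 2 * ℓ - k + 1} : Finset ℕ))
    then 1 else 0

/-- The product over the parts `a` in a list of the factors
`s_{o+1} s_{o+2} ⋯ s_{o+a-1} t_{o+a}`, where `o` is the sum of the parts already treated. -/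
def blockProd (ℓ : ℕ) : ℕ → List ℕ → Matrix (Fin (2 * ℓ)) (Fin (2 * ℓ)) ℂ
  | _, [] => 1
  | o, a :: as =>
    ((List.range (a - 1)).map fun i => sMat ℓ (o + i + 1)).prod * tMat ℓ (o + a) *
      blockProd ℓ (o + a) as

/-- The element `n` attached to the partition `ℓ_1 ≤ ℓ_2 ≤ ⋯ ≤ ℓ_μ`. -/
def nMat {ℓ : ℕ} (p : Nat.Partition ℓ) : Matrix (Fin (2 * ℓ)) (Fin (2 * ℓ)) ℂ :=
  blockProd ℓ 0 (p.parts.sort (· ≤ ·))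

/-! ### The numbers `σ_k` and the labels built from them -/

/-- `m = 2 lcm(ℓ_1, …, ℓ_μ)`. -/
def mOf {ℓ : ℕ} (p : Nat.Partition ℓ) : ℕ := 2 * p.parts.lcm

/-- The numbers `a m / (2 ℓ_ν)` (`1 ≤ a ≤ ℓ_ν - 1`), with `μ/2` copies of `m/2` and `μ/2` zeroes.
All divisions are exact if `μ` is even. -/
def entries {ℓ : ℕ} (p : Nat.Partition ℓ) : Multiset ℕ :=
  (p.parts.bind fun q => (Finset.Icc 1 (q - 1)).val.map fun a => a * mOf p / (2 * q)) +
    Multiset.replicate (p.parts.card / 2) (mOf p / 2) +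
    Multiset.replicate (p.parts.card / 2) 0

/-- `σ p k` is the `k`-th of these numbers in decreasing order, counted from `k = 1`. -/
def σ {ℓ : ℕ} (p : Nat.Partition ℓ) (k : ℕ) : ℤ :=
  (((entries p).sort (· ≥ ·)).getD (k - 1) 0 : ℕ)

/-- There are exactly `ℓ` of these numbers, so that `σ_1, …, σ_ℓ` are all of them. -/
theorem card_entries {ℓ : ℕ} (p : Nat.Partition ℓ) (hp : Even p.parts.card) :
    (entries p).card = ℓ := by
  have key : ∀ s : Multiset ℕ, (∀ q ∈ s, 0 < q) →
      (s.map fun q => q - 1).sum + s.card = s.sum := by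
    intro s
    induction s using Multiset.induction_on with
    | empty => simp
    | cons a s ih =>
      intro h
      have h1 := ih fun q hq => h q (Multiset.mem_cons_of_mem hq)
      have h2 := h a (Multiset.mem_cons_self a s)
      simp only [Multiset.map_cons, Multiset.sum_cons, Multiset.card_cons]
      omega
  have h := key p.parts fun q hq => p.parts_pos hq
  rw [p.parts_sum] at h
  obtain ⟨c, hc⟩ := hp
  simp only [entries, Multiset.card_add, Multiset.card_bind, Multiset.card_replicate,
    Function.comp_def, Multiset.card_map, Finset.card_val, Nat.card_Icc, Nat.add_sub_cancel]
  omega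

/-- The labels: `m - (σ_1 + σ_2)` on `γ_0`, `σ_k - σ_{k+1}` on `γ_k` for `1 ≤ k ≤ ℓ - 1`, and
`σ_{ℓ-1} + σ_ℓ` on `γ_ℓ`. The nodes `γ_0`, `γ_1` form one fork of the affine Dynkin diagram, and
`γ_{ℓ-1}`, `γ_ℓ` the other one. -/
def sigmaLabels {ℓ : ℕ} (p : Nat.Partition ℓ) : Fin (ℓ + 1) → ℤ := fun k =>
  if (k : ℕ) = 0 then mOf p - (σ p 1 + σ p 2)
  else if (k : ℕ) < ℓ then σ p k - σ p (k + 1)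
  else σ p (ℓ - 1) + σ p ℓ

end KacD

/-!
The matrix `n` is that of a permutation of the `2ℓ` basis vectors, a product of disjoint signed
cycles of lengths `2ℓ_1, …, 2ℓ_μ`. Its order is therefore `m`, and its characteristic polynomial is
the product of the `X ^ (2ℓ_ν) - 1`, whose roots are the numbers `ξ ^ (±σ_k)`.

A matrix `P` with `P⁻¹ n P = σ(ξ)` becomes orthogonal after division by a square root of `P* P`,
where `P*` is the adjoint of `P` with respect to the bilinear form. Since `σ_ℓ = 0`, some reflection
commutes with `σ(ξ)`, so that the determinant can be made `1`.

Conversely, if `n` is conjugate to `lam(ξ)`, then up to order and signs the `lam_k` are congruent to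
the `σ_k` modulo `m`. As `m/2` and `0` occur among the `σ_k`, a point `lam / m` of the closed alcove
with this property is fixed by the symmetries that interchange the two nodes of either fork, and
this leaves only `lam = σ`.
-/

namespace KacD

open Polynomial

theorem exists_isNilpotent_aeval_sq_sub {k A : Type*} [Field k] [IsAlgClosed k] [Ring A]
    [Algebra k A] {a : A} (ha : IsIntegral k a) : ∃ q : k[X], IsNilpotent (aeval a q ^ 2 - a) := by
  classical
  choose r hr using fun z : k => IsAlgClosed.exists_pow_nat_eq z two_pos
  set s := (minpoly k a).roots
  let q := Lagrange.interpolate s.toFinset id r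
  have hq : ∀ z ∈ s, X - C z ∣ q ^ 2 - X := fun z hz => by
    have : q.eval z = r z := Lagrange.eval_interpolate_at_node r Function.injective_id.injOn
      (Multiset.mem_toFinset.2 hz)
    simp [dvd_iff_isRoot, this, hr]
  have hdvd : minpoly k a ∣ (q ^ 2 - X) ^ s.card := by
    rw [(IsAlgClosed.splits (minpoly k a)).eq_prod_roots_of_monic (minpoly.monic ha)]
    simpa using Multiset.prod_dvd_prod_of_dvd _ _ hq
  exact ⟨q, s.card, by simpa using (minpoly.dvd_iff).1 hdvd⟩

theorem exists_sq_eq_of_isNilpotent_sub {R : Type*} [CommRing R] (h2 : IsUnit (2 : R)) {a x : R}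
    (ha : IsUnit a) (hx : IsNilpotent (x ^ 2 - a)) : ∃ b : R, b ^ 2 = a := by
  have hxu : IsUnit x := by
    have h := hx.isUnit_add_left_of_commute ha (Commute.all _ _)
    rwa [add_sub_cancel, isUnit_pow_iff two_ne_zero] at h
  obtain ⟨b, ⟨-, hb⟩, -⟩ := existsUnique_nilpotent_sub_and_aeval_eq_zero
    (P := X ^ 2 - C a) (x := x) (by simpa using hx) (by simpa [one_add_one_eq_two] using h2.mul hxu)
  exact ⟨b, by simpa [sub_eq_zero] using hb⟩

theorem exists_mem_adjoin_sq_eq {k A : Type*} [Field k] [IsAlgClosed k] (h2 : (2 : k) ≠ 0)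
    [Ring A] [Algebra k A] {a : A} (ha : IsIntegral k a) (hu : IsUnit a) :
    ∃ b ∈ Algebra.adjoin k {a}, b ^ 2 = a := by
  let a' : Algebra.adjoin k {a} := ⟨a, Algebra.self_mem_adjoin_singleton k a⟩
  have : Module.Finite k (Algebra.adjoin k {a}) := Algebra.finite_adjoin_simple_of_isIntegral ha
  have ha' : IsUnit a' := by
    have : IsArtinianRing (Algebra.adjoin k {a}) := IsArtinianRing.of_finite k _
    refine IsArtinianRing.isUnit_of_mem_nonZeroDivisors ?_
    rw [mem_nonZeroDivisors_iff_right]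
    exact fun x hx => Subtype.ext (hu.mul_left_eq_zero.1 (congrArg Subtype.val hx))
  obtain ⟨q, hq⟩ := exists_isNilpotent_aeval_sq_sub (k := k) (IsIntegral.of_finite k a')
  have h2' : IsUnit (2 : Algebra.adjoin k {a}) :=
    map_ofNat (algebraMap k (Algebra.adjoin k {a})) 2 ▸ (IsUnit.mk0 2 h2).map _
  obtain ⟨b, hb⟩ := exists_sq_eq_of_isNilpotent_sub h2' ha' hq
  exact ⟨b, b.2, congrArg Subtype.val hb⟩

section AntiInvolution

variable {k A : Type*} [Field k] [Ring A] [Algebra k A] {φ : A →ₗ[k] A}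

theorem antiInvolution_map_one (hmul : ∀ a b, φ (a * b) = φ b * φ a) (hφ : ∀ a, φ (φ a) = a) :
    φ 1 = 1 := by
  simpa [hφ] using (hmul (φ 1) 1).symm

theorem antiInvolution_apply_of_mem_adjoin (hmul : ∀ a b, φ (a * b) = φ b * φ a)
    (hφ : ∀ a, φ (φ a) = a) {a b : A} (ha : φ a = a) (hb : b ∈ Algebra.adjoin k {a}) :
    φ b = b := by
  have hcomm {x y : A} (hx : x ∈ Algebra.adjoin k {a}) (hy : y ∈ Algebra.adjoin k {a}) :
      y * x = x * y :=
    congrArg Subtype.val (mul_comm (⟨y, hy⟩ : Algebra.adjoin k {a}) ⟨x, hx⟩)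
  induction hb using Algebra.adjoin_induction with
  | mem x hx => rwa [Set.mem_singleton_iff.1 hx]
  | algebraMap r =>
    rw [Algebra.algebraMap_eq_smul_one, map_smul, antiInvolution_map_one hmul hφ]
  | add x y _ _ hx hy => rw [map_add, hx, hy]
  | mul x y hx' hy' hx hy => rw [hmul, hx, hy, hcomm hx' hy']

/-- For the square root `r` of `φ p * p` in `k[φ p * p]`, the quotient `p * r⁻¹` is unitary, as `r`
is fixed by `φ`, and it still conjugates `g` to `d`, as `d` commutes with `φ p * p`. -/
theorem exists_unitary_conj_of_conj [IsAlgClosed k] [FiniteDimensional k A] (h2 : (2 : k) ≠ 0)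
    (hmul : ∀ a b, φ (a * b) = φ b * φ a) (hφ : ∀ a, φ (φ a) = a) {g d p : A}
    (hg : φ g * g = 1) (hd : d * φ d = 1) (hp : IsUnit p) (hgp : g * p = p * d) :
    ∃ h : A, φ h * h = 1 ∧ g * h = h * d := by
  have hφp : IsUnit (φ p) := by
    obtain ⟨u, rfl⟩ := hp
    have h1 := antiInvolution_map_one hmul hφ
    exact ⟨⟨φ u, φ ↑u⁻¹, by rw [← hmul, u.inv_mul, h1], by rw [← hmul, u.mul_inv, h1]⟩, rfl⟩
  have hφpg : φ p * g = d * φ p := by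
    calc φ p * g = d * (φ d * φ p) * g := by rw [← mul_assoc, hd, one_mul]
      _ = d * φ p * (φ g * g) := by rw [← hmul, ← hgp, hmul]; simp only [mul_assoc]
      _ = d * φ p := by rw [hg, mul_one]
  obtain ⟨r, hr, hr2⟩ := exists_mem_adjoin_sq_eq h2 (IsIntegral.of_finite k (φ p * p))
    (hφp.mul hp)
  have hφr : φ r = r := antiInvolution_apply_of_mem_adjoin hmul hφ (by rw [hmul, hφ]) hr
  have hdr : Commute d r := Algebra.commute_of_mem_adjoin_singleton_of_commute hr <| by
    rw [Commute, SemiconjBy, ← mul_assoc, ← hφpg, mul_assoc, hgp, mul_assoc]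
  obtain ⟨u, rfl⟩ : IsUnit r := (isUnit_pow_iff two_ne_zero).1 (hr2 ▸ hφp.mul hp)
  have hφu : φ ↑u⁻¹ = (↑u⁻¹ : A) := (Units.inv_eq_of_mul_eq_one_left <| by
    rw [← congrArg (φ ↑u⁻¹ * ·) hφr, ← hmul, u.mul_inv, antiInvolution_map_one hmul hφ]).symm
  refine ⟨p * ↑u⁻¹, ?_, ?_⟩
  · calc φ (p * ↑u⁻¹) * (p * ↑u⁻¹) = ↑u⁻¹ * (φ p * p) * ↑u⁻¹ := by
          rw [hmul, hφu]; simp only [mul_assoc]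
      _ = 1 := by rw [← hr2, sq]; simp
  · rw [← mul_assoc, hgp, mul_assoc, mul_assoc, (hdr.units_inv_right).eq]

end AntiInvolution

theorem exists_perm_of_map_univ_eq {ι α : Type*} [Fintype ι] {f g : ι → α}
    (h : Finset.univ.val.map f = Finset.univ.val.map g) :
    ∃ τ : Equiv.Perm ι, ∀ i, f i = g (τ i) := by
  classical
  have hc (c : α) : Nonempty ({a // f a = c} ≃ {a // g a = c}) := by
    have := congrArg (Multiset.count c) h
    rw [← Fintype.card_eq, Fintype.card_subtype, Fintype.card_subtype]
    simpa only [Multiset.count_map, eq_comm (a := c), Finset.card_def, Finset.filter_val]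
      using this
  exact ⟨Equiv.ofFiberEquiv fun c => (hc c).some, fun i => (Equiv.ofFiberEquiv_map _ i).symm⟩

section Diagonalization

variable {k n : Type*} [Field k] [Fintype n] [DecidableEq n] {M : Matrix n n k}

theorem isSemisimple_toLin'_of_pow_eq_one {m : ℕ} (hm : (m : k) ≠ 0) (hM : M ^ m = 1) :
    Module.End.IsSemisimple (toLin' M) :=
  Module.End.isSemisimple_of_squarefree_aeval_eq_zero (p := X ^ m - 1)
    (X_pow_sub_one_separable_iff.2 hm).squarefree
    (by rw [map_sub, map_one, map_pow, aeval_X, ← toLin'_pow, hM, toLin'_one]; exact sub_self _)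

theorem charpoly_eq_of_mul_eq_mul {R : Type*} [CommRing R] {M N P : Matrix n n R} (hP : IsUnit P)
    (h : M * P = P * N) : M.charpoly = N.charpoly := by
  obtain ⟨u, rfl⟩ := hP
  rw [← charpoly_units_conj u N, ← h, mul_assoc, ← coe_units_inv, u.mul_inv, mul_one]

theorem roots_charpoly_diagonal {R : Type*} [CommRing R] [IsDomain R] (d : n → R) :
    (diagonal d).charpoly.roots = Finset.univ.val.map d := by
  simpa [charpoly_diagonal, Multiset.map_map, Function.comp_def] using
    roots_multiset_prod_X_sub_C (Finset.univ.val.map d)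

variable [IsAlgClosed k]

theorem exists_mul_eq_mul_diagonal_of_isSemisimple (hM : Module.End.IsSemisimple (toLin' M)) :
    ∃ P : Matrix n n k, ∃ d : n → k, IsUnit P ∧ M * P = P * diagonal d := by
  let s : Set (n → k) := {v | ∃ μ : k, M *ᵥ v = μ • v}
  have hs : ⊤ ≤ Submodule.span k s := by
    rw [← hM.iSup_eigenspace_eq_top]
    exact iSup_le fun μ v hv => Submodule.subset_span
      ⟨μ, by simpa using Module.End.mem_eigenspace_iff.1 hv⟩
  let b := Module.Basis.ofSpan hs
  have := FiniteDimensional.fintypeBasisIndex b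
  let b' := b.reindex (b.indexEquiv (Pi.basisFun k n))
  have hb (i : n) : ∃ μ : k, M *ᵥ b' i = μ • b' i :=
    Module.Basis.ofSpan_subset hs ⟨_, (b.reindex_apply _ i).symm⟩
  choose d hd using hb
  refine ⟨(Pi.basisFun k n).toMatrix b', d, ?_, ?_⟩
  · have := (Pi.basisFun k n).invertibleToMatrix b'
    exact isUnit_of_invertible _
  · ext i j
    rw [mul_diagonal]
    simpa [mul_apply, mulVec, dotProduct, Module.Basis.toMatrix_apply, mul_comm]
      using congrFun (hd j) i

theorem exists_mul_eq_mul_diagonal_of_charpoly_eq (hM : Module.End.IsSemisimple (toLin' M))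
    {d : n → k} (hd : M.charpoly = (diagonal d).charpoly) :
    ∃ P : Matrix n n k, IsUnit P ∧ M * P = P * diagonal d := by
  obtain ⟨P, d', hP, hPd⟩ := exists_mul_eq_mul_diagonal_of_isSemisimple hM
  obtain ⟨τ, hτ⟩ := exists_perm_of_map_univ_eq (f := d) (g := d') <| by
    rw [← roots_charpoly_diagonal, ← roots_charpoly_diagonal, ← hd,
      charpoly_eq_of_mul_eq_mul hP hPd]
  refine ⟨P.submatrix id τ, ?_, ?_⟩
  · exact (isUnit_submatrix_equiv (Equiv.refl n) τ).2 hP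
  · have hd' : (diagonal d').submatrix τ τ = diagonal d := by
      rw [submatrix_diagonal_equiv]; exact congrArg diagonal (funext fun i => (hτ i).symm)
    calc M * P.submatrix id τ = (M * P).submatrix id τ := rfl
      _ = P.submatrix id τ * (diagonal d').submatrix τ τ := by
        rw [hPd, submatrix_mul_equiv]
      _ = P.submatrix id τ * diagonal d := by rw [hd']

end Diagonalization

section PermMatrix

variable {n R : Type*} [DecidableEq n]

theorem permMatrix_apply [Zero R] [One R] (τ : Equiv.Perm n) (i j : n) :
    τ.permMatrix R i j = if τ i = j then 1 else 0 := by
  simp [PEquiv.toMatrix_apply, eq_comm]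

theorem permMatrix_injective [Semiring R] [Nontrivial R] :
    Function.Injective (fun τ : Equiv.Perm n => τ.permMatrix R) := fun _ _ h =>
  Equiv.ext fun i => Option.some_injective _ <|
    congrArg (fun f : n ≃. n => f i) (PEquiv.toMatrix_injective h)

variable [Fintype n]

theorem permMatrix_pow [Semiring R] (τ : Equiv.Perm n) (k : ℕ) :
    (τ ^ k).permMatrix R = τ.permMatrix R ^ k := by
  induction k with
  | zero => simp
  | succ k ih => rw [pow_succ, permMatrix_mul, ih, ← pow_succ']

theorem orderOf_permMatrix [Semiring R] [Nontrivial R] (τ : Equiv.Perm n) :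
    orderOf (τ.permMatrix R) = orderOf τ :=
  orderOf_eq_orderOf_iff.2 fun k => by
    rw [← permMatrix_pow, ← permMatrix_one (n := n) (R := R)]
    exact permMatrix_injective.eq_iff

variable [CommRing R]

theorem eq_zero_of_aeval_permMatrix_eq_zero {τ : Equiv.Perm n}
    (hτ : τ.IsCycleOn (Finset.univ : Finset n)) {r : R[X]} (hr : r.degree < Fintype.card n)
    (h : aeval (τ.permMatrix R) r = 0) : r = 0 := by
  by_contra h0
  rw [degree_eq_natDegree h0, Nat.cast_lt] at hr
  obtain ⟨a⟩ : Nonempty n := Fintype.card_pos_iff.1 (by omega)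
  rw [aeval_eq_sum_range' hr] at h
  refine leadingCoeff_ne_zero.2 h0 ?_
  have ha := congrFun (congrFun h a) ((τ ^ r.natDegree) a)
  rw [Matrix.sum_apply, Finset.sum_eq_single_of_mem _ (Finset.mem_range.2 hr)] at ha
  · simpa [← permMatrix_pow, permMatrix_apply] using ha
  · intro i hi hne
    rw [← permMatrix_pow, Matrix.smul_apply, permMatrix_apply, if_neg, smul_zero]
    rw [hτ.pow_apply_eq_pow_apply (Finset.mem_univ a)]
    exact fun hmod => hne (hmod.eq_of_lt_of_lt (Finset.mem_range.1 hi) hr)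

theorem charpoly_permMatrix_of_isCycleOn [Nonempty n] {τ : Equiv.Perm n}
    (hτ : τ.IsCycleOn (Finset.univ : Finset n)) :
    (τ.permMatrix R).charpoly = X ^ Fintype.card n - 1 := by
  nontriviality R
  have hpow : τ ^ Fintype.card n = 1 :=
    Equiv.ext fun a => hτ.pow_card_apply (Finset.mem_univ a)
  have hmonic : (X ^ Fintype.card n - 1 : R[X]).Monic := monic_X_pow_sub_C 1 Fintype.card_ne_zero
  have hdeg : (X ^ Fintype.card n - 1 : R[X]).degree = Fintype.card n :=
    degree_X_pow_sub_C Fintype.card_pos 1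
  rw [← sub_eq_zero]
  refine eq_zero_of_aeval_permMatrix_eq_zero hτ ?_ ?_
  · rw [← charpoly_degree_eq_dim (τ.permMatrix R)] at hdeg ⊢
    exact degree_sub_lt_left hdeg.symm (charpoly_monic _).ne_zero
      ((charpoly_monic _).trans hmonic.symm)
  · rw [map_sub, aeval_self_charpoly, zero_sub, map_sub, map_pow, aeval_X, map_one,
      ← permMatrix_pow, hpow, permMatrix_one, sub_self, neg_zero]

theorem charpoly_permMatrix_eq_mul_subtypePerm (τ : Equiv.Perm n) (p : n → Prop)
    [DecidablePred p] (hp : ∀ i, p (τ i) ↔ p i) :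
    (τ.permMatrix R).charpoly = ((τ.subtypePerm hp).permMatrix R).charpoly *
      ((τ.subtypePerm (p := fun i => ¬p i) fun i => not_congr (hp i)).permMatrix R).charpoly := by
  rw [← charpoly_fromBlocks_zero₁₂ (M₂₁ := 0), ← charpoly_reindex (Equiv.sumCompl p).symm]
  congr 1
  ext (i | i) (j | j)
  · simp [Subtype.ext_iff]
  · have : τ i ≠ j := fun h => j.2 (h ▸ (hp i).2 i.2)
    simp [this]
  · have : τ i ≠ j := fun h => i.2 ((hp i).1 (h ▸ j.2))
    simp [this]
  · simp [Subtype.ext_iff]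

theorem charpoly_permMatrix_of_isCycle {τ : Equiv.Perm n} (hτ : τ.IsCycle) :
    (τ.permMatrix R).charpoly =
      (X ^ τ.support.card - 1) * (X - 1) ^ (Fintype.card n - τ.support.card) := by
  have hp (i : n) : τ (τ i) ≠ τ i ↔ τ i ≠ i := τ.injective.ne_iff
  have hne : Nonempty {i // τ i ≠ i} := let ⟨i, hi, _⟩ := hτ; ⟨i, hi⟩
  have hmoved : (τ.subtypePerm (p := fun i => τ i ≠ i) hp).IsCycleOn
      (Finset.univ : Finset {i // τ i ≠ i}) := by
    rw [Finset.coe_univ]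
    exact hτ.isCycleOn.subtypePerm
  have hfixed : (τ.subtypePerm (p := fun i => ¬τ i ≠ i) fun i => not_congr (hp i)) = 1 :=
    Equiv.ext fun i => Subtype.ext (not_not.1 i.2)
  rw [charpoly_permMatrix_eq_mul_subtypePerm τ (fun i => τ i ≠ i) hp,
    charpoly_permMatrix_of_isCycleOn hmoved, hfixed, permMatrix_one, charpoly_one,
    Fintype.card_subtype_compl fun i => τ i ≠ i,
    Fintype.card_of_subtype τ.support fun _ => Equiv.Perm.mem_support]

theorem charpoly_permMatrix_mul_of_disjoint {τ π : Equiv.Perm n} (h : τ.Disjoint π) :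
    (τ.permMatrix R).charpoly * (π.permMatrix R).charpoly =
      (X - 1) ^ Fintype.card n * ((τ * π).permMatrix R).charpoly := by
  have hτ (i : n) : τ (τ i) ≠ τ i ↔ τ i ≠ i := τ.injective.ne_iff
  have hπ (i : n) : τ (π i) ≠ π i ↔ τ i ≠ i := by
    rw [← Equiv.Perm.mul_apply, h.commute.eq, Equiv.Perm.mul_apply, π.injective.ne_iff]
  have hτπ (i : n) : τ ((τ * π) i) ≠ (τ * π) i ↔ τ i ≠ i := (hτ (π i)).trans (hπ i)
  have hπ₁ : π.subtypePerm (p := fun i => τ i ≠ i) hπ = 1 :=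
    Equiv.ext fun i => Subtype.ext ((h i).resolve_left i.2)
  have hτ₂ : (τ.subtypePerm (p := fun i => ¬τ i ≠ i) fun i => not_congr (hτ i)) = 1 :=
    Equiv.ext fun i => Subtype.ext (not_not.1 i.2)
  have h₁ : (τ * π).subtypePerm (p := fun i => τ i ≠ i) hτπ = τ.subtypePerm hτ := by
    rw [← mul_one (τ.subtypePerm _), ← hπ₁]; rfl
  have h₂ : ((τ * π).subtypePerm (p := fun i => ¬τ i ≠ i) fun i => not_congr (hτπ i)) =
      π.subtypePerm fun i => not_congr (hπ i) := by
    rw [← one_mul (π.subtypePerm _), ← hτ₂]; rfl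
  have hone : (X - 1) ^ Fintype.card n =
      ((1 : Equiv.Perm {i // τ i ≠ i}).permMatrix R).charpoly *
        ((1 : Equiv.Perm {i // ¬τ i ≠ i}).permMatrix R).charpoly := by
    rw [← charpoly_one, ← permMatrix_one]
    exact charpoly_permMatrix_eq_mul_subtypePerm 1 (fun i => τ i ≠ i) fun _ => Iff.rfl
  rw [hone, charpoly_permMatrix_eq_mul_subtypePerm τ (fun i => τ i ≠ i) hτ,
    charpoly_permMatrix_eq_mul_subtypePerm π (fun i => τ i ≠ i) hπ,
    charpoly_permMatrix_eq_mul_subtypePerm (τ * π) (fun i => τ i ≠ i) hτπ, h₁, h₂, hτ₂, hπ₁]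
  ring

theorem charpoly_permMatrix (τ : Equiv.Perm n) :
    (τ.permMatrix R).charpoly = (τ.partition.parts.map fun q => (X ^ q - 1 : R[X])).prod := by
  have hparts (τ : Equiv.Perm n) : (τ.partition.parts.map fun q => (X ^ q - 1 : R[X])).prod =
      (τ.cycleType.map fun q => (X ^ q - 1 : R[X])).prod *
        (X - 1) ^ (Fintype.card n - τ.support.card) := by
    simp [Equiv.Perm.parts_partition]
  induction τ using Equiv.Perm.cycle_induction_on with
  | base_one => rw [permMatrix_one, charpoly_one]; simp [hparts]
  | base_cycles τ hτ => simp [hparts, charpoly_permMatrix_of_isCycle hτ, hτ.cycleType]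
  | induction_disjoint τ π h _ hτ hπ =>
    have hcard : τ.support.card + π.support.card ≤ Fintype.card n := by
      rw [← h.card_support_mul]; exact Finset.card_le_univ _
    have hreg : IsLeftRegular ((X - 1 : R[X]) ^ Fintype.card n) :=
      ((monic_X_sub_C 1).pow _).isRegular.left
    apply hreg
    beta_reduce
    rw [← charpoly_permMatrix_mul_of_disjoint h, hτ, hπ, hparts, hparts, hparts, h.cycleType_mul,
      Multiset.map_add, Multiset.prod_add, h.card_support_mul, mul_mul_mul_comm, ← pow_add,
      mul_left_comm, ← pow_add]
    congr 2
    omega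

end PermMatrix

section AntiTranspose

variable {R : Type*} {n : ℕ}

/-- The transpose of a square matrix about its anti-diagonal. This is the adjoint with respect to
the symmetric bilinear form whose Gram matrix is `antiDiag n`. -/
def antiTranspose [Semiring R] : Matrix (Fin n) (Fin n) R →ₗ[R] Matrix (Fin n) (Fin n) R where
  toFun M := Mᵀ.submatrix Fin.rev Fin.rev
  map_add' _ _ := rfl
  map_smul' _ _ := rfl

theorem antiTranspose_apply [Semiring R] (M : Matrix (Fin n) (Fin n) R) :
    antiTranspose M = Mᵀ.submatrix Fin.revPerm Fin.revPerm := rfl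

theorem antiTranspose_antiTranspose [Semiring R] (M : Matrix (Fin n) (Fin n) R) :
    antiTranspose (antiTranspose M) = M := by
  ext i j
  simp [antiTranspose_apply]

theorem antiTranspose_mul [CommSemiring R] (M N : Matrix (Fin n) (Fin n) R) :
    antiTranspose (M * N) = antiTranspose N * antiTranspose M := by
  simp only [antiTranspose_apply, transpose_mul, submatrix_mul_equiv]

theorem det_antiTranspose [CommRing R] (M : Matrix (Fin n) (Fin n) R) :
    (antiTranspose M).det = M.det := by
  rw [antiTranspose_apply, det_submatrix_equiv_self, det_transpose]

theorem antiTranspose_diagonal [Semiring R] (d : Fin n → R) :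
    antiTranspose (diagonal d) = diagonal (d ∘ Fin.rev) := by
  rw [antiTranspose_apply, diagonal_transpose, submatrix_diagonal_equiv]
  rfl

theorem antiTranspose_permMatrix [Semiring R] {τ : Equiv.Perm (Fin n)}
    (hτ : Commute Fin.revPerm τ) : antiTranspose (τ.permMatrix R) = τ⁻¹.permMatrix R := by
  ext i j
  have : τ⁻¹ (Fin.rev i) = Fin.rev (τ⁻¹ i) := (Equiv.congr_fun (hτ.inv_right).eq i).symm
  simp [antiTranspose_apply, transpose_permMatrix, this]

theorem antiDiag_eq_permMatrix (n : ℕ) : antiDiag n = Fin.revPerm.permMatrix ℂ := by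
  ext i j
  simp [antiDiag, eq_comm]

theorem transpose_antiDiag_mul_mul_antiDiag (M : Matrix (Fin n) (Fin n) ℂ) :
    (antiDiag n * M * antiDiag n)ᵀ = antiTranspose M := by
  rw [antiDiag_eq_permMatrix, PEquiv.toMatrix_toPEquiv_mul, PEquiv.mul_toMatrix_toPEquiv]
  rfl

theorem mem_SO_iff {ℓ : ℕ} {g : Matrix (Fin (2 * ℓ)) (Fin (2 * ℓ)) ℂ} :
    g ∈ SO ℓ ↔ antiTranspose g * g = 1 ∧ g.det = 1 := by
  refine and_congr_left fun hdet => ?_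
  have hg : IsUnit g.det := hdet ▸ isUnit_one
  rw [transpose_antiDiag_mul_mul_antiDiag]
  constructor
  · intro h
    nth_rw 1 [h]
    rw [antiTranspose_antiTranspose, nonsing_inv_mul _ hg]
  · intro h
    rw [inv_eq_left_inv h, antiTranspose_antiTranspose]

theorem permMatrix_mem_SO {ℓ : ℕ} {τ : Equiv.Perm (Fin (2 * ℓ))} (hτ : Commute Fin.revPerm τ)
    (hsign : Equiv.Perm.sign τ = 1) : τ.permMatrix ℂ ∈ SO ℓ := by
  rw [mem_SO_iff, antiTranspose_permMatrix hτ, ← permMatrix_mul, mul_inv_cancel, permMatrix_one,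
    det_permutation, hsign]
  exact ⟨rfl, by norm_num⟩

end AntiTranspose

section SignedCycle

variable {α : Type*} [DecidableEq α] {r : Equiv.Perm α}

/-- The signed cycle `x_1 → ⋯ → x_a → r x_1 → ⋯ → r x_a → x_1`, where `r` is an involution that
plays the role of the sign change. -/
def signedCycle (r : Equiv.Perm α) (xs : List α) : Equiv.Perm α :=
  (xs ++ xs.map r).formPerm

theorem signedCycle_singleton (x : α) : signedCycle r [x] = Equiv.swap x (r x) :=
  List.formPerm_pair x (r x)

theorem signedCycle_cons_cons {x y : α} {ys : List α}
    (h : ((x :: y :: ys) ++ (x :: y :: ys).map r).Nodup) :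
    signedCycle r (x :: y :: ys) =
      Equiv.swap x y * Equiv.swap (r x) (r y) * signedCycle r (y :: ys) := by
  have hnodup : ((y :: ys) ++ (r x :: r y :: ys.map r)).Nodup := (List.nodup_cons.1 h).2
  have hrotate : ((y :: ys) ++ (r x :: r y :: ys.map r)).formPerm =
      ((r x :: r y :: ys.map r) ++ (y :: ys)).formPerm :=
    List.formPerm_eq_of_isRotated hnodup List.isRotated_append
  have hnodup' : ((r y :: ys.map r) ++ (y :: ys)).Nodup :=
    (List.nodup_cons.1 (List.nodup_append_comm.1 hnodup)).2
  have hrotate' : ((r y :: ys.map r) ++ (y :: ys)).formPerm = signedCycle r (y :: ys) :=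
    List.formPerm_eq_of_isRotated hnodup' List.isRotated_append
  calc signedCycle r (x :: y :: ys)
      = Equiv.swap x y * ((y :: ys) ++ (r x :: r y :: ys.map r)).formPerm :=
        List.formPerm_cons_cons ..
    _ = Equiv.swap x y * (Equiv.swap (r x) (r y) * ((r y :: ys.map r) ++ (y :: ys)).formPerm) := by
        rw [hrotate]; exact congrArg _ (List.formPerm_cons_cons ..)
    _ = _ := by rw [hrotate', mul_assoc]

theorem formPerm_map (π : Equiv.Perm α) :
    ∀ xs : List α, (xs.map π).formPerm = π * xs.formPerm * π⁻¹
  | [] | [_] => by simp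
  | x :: y :: ys => by
    rw [List.formPerm_cons_cons, List.map_cons, List.map_cons, List.formPerm_cons_cons,
      ← List.map_cons, formPerm_map π (y :: ys), Equiv.swap_apply_apply]
    group

theorem commute_signedCycle (hr : r * r = 1) {xs : List α} (h : (xs ++ xs.map r).Nodup) :
    Commute r (signedCycle r xs) := by
  have hmap : (xs ++ xs.map r).map r = xs.map r ++ xs := by
    rw [List.map_append, List.map_map, ← Equiv.Perm.coe_mul, hr, Equiv.Perm.coe_one, List.map_id]
  have hconj := formPerm_map r (xs ++ xs.map r)
  rw [hmap, List.formPerm_eq_of_isRotated (List.nodup_append_comm.1 h) List.isRotated_append,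
    eq_mul_inv_iff_mul_eq] at hconj
  exact hconj.symm

theorem cycleType_signedCycle [Fintype α] {xs : List α} (hxs : xs ≠ [])
    (h : (xs ++ xs.map r).Nodup) : (signedCycle r xs).cycleType = {2 * xs.length} := by
  have hlength : (xs ++ xs.map r).length = 2 * xs.length := by simp [two_mul]
  have hpos := List.length_pos_iff.2 hxs
  have hne (x : α) : xs ++ xs.map r ≠ [x] := fun hx => by
    have := congrArg List.length hx
    simp only [List.length_singleton] at this
    omega
  rw [signedCycle, (List.isCycle_formPerm h (by omega)).cycleType,
    List.support_formPerm_of_nodup _ h hne, List.toFinset_card_of_nodup h, hlength]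

theorem mem_of_signedCycle_apply_ne {xs : List α} {i : α} (h : signedCycle r xs i ≠ i) :
    i ∈ xs ++ xs.map r :=
  List.mem_of_formPerm_apply_ne h

end SignedCycle

section Block

variable {ℓ : ℕ}

/-- The indices `o, …, o + a - 1` of the rows of a `2ℓ × 2ℓ` matrix, counted from `0`. -/
def block (ℓ o a : ℕ) : List (Fin (2 * ℓ)) :=
  ((List.finRange (2 * ℓ)).drop o).take a

theorem block_succ {o a : ℕ} (h : o < 2 * ℓ) :
    block ℓ o (a + 1) = ⟨o, h⟩ :: block ℓ (o + 1) a := by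
  rw [block, List.drop_eq_getElem_cons (by simpa using h), List.take_succ_cons]
  simp [block]

theorem length_block {o a : ℕ} (h : o + a ≤ 2 * ℓ) : (block ℓ o a).length = a := by
  simp only [block, List.length_take, List.length_drop, List.length_finRange]
  omega

theorem nodup_block (o a : ℕ) : (block ℓ o a).Nodup :=
  (List.nodup_finRange _).sublist ((List.take_sublist ..).trans (List.drop_sublist ..))

theorem mem_block {o a : ℕ} {i : Fin (2 * ℓ)} (h : o + a ≤ 2 * ℓ) :
    i ∈ block ℓ o a ↔ o ≤ (i : ℕ) ∧ (i : ℕ) < o + a := by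
  induction a generalizing o with
  | zero => simp [block]
  | succ a ih =>
    rw [block_succ (by omega), List.mem_cons, ih (by omega), Fin.ext_iff]
    dsimp only
    omega

theorem mem_block_append_map_rev {o a : ℕ} {i : Fin (2 * ℓ)} (h : o + a ≤ ℓ) :
    i ∈ block ℓ o a ++ (block ℓ o a).map Fin.revPerm ↔
      (o ≤ (i : ℕ) ∧ (i : ℕ) < o + a) ∨ (o ≤ (i.rev : ℕ) ∧ (i.rev : ℕ) < o + a) := by
  have hmap : i ∈ (block ℓ o a).map Fin.revPerm ↔ i.rev ∈ block ℓ o a := by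
    rw [List.mem_map]
    exact ⟨by rintro ⟨j, hj, rfl⟩; simpa using hj, fun hi => ⟨_, hi, by simp⟩⟩
  rw [List.mem_append, hmap, mem_block (by omega), mem_block (by omega)]

theorem nodup_block_append_map_rev {o a : ℕ} (h : o + a ≤ ℓ) :
    (block ℓ o a ++ (block ℓ o a).map Fin.revPerm).Nodup := by
  refine List.nodup_append'.2
    ⟨nodup_block o a, (nodup_block o a).map Fin.revPerm.injective, fun i hi hi' => ?_⟩
  obtain ⟨j, hj, rfl⟩ := List.mem_map.1 hi'
  rw [mem_block (by omega)] at hi hj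
  simp only [Fin.revPerm_apply, Fin.val_rev] at hi
  omega

theorem sMat_eq_permMatrix {k : ℕ} (hk : k + 1 < ℓ) :
    sMat ℓ (k + 1) =
      (Equiv.swap (Fin.rev ⟨k, by omega⟩) (Fin.rev ⟨k + 1, by omega⟩) *
        Equiv.swap (⟨k, by omega⟩ : Fin (2 * ℓ)) ⟨k + 1, by omega⟩).permMatrix ℂ := by
  ext i j
  rw [permMatrix_apply, sMat, Matrix.of_apply]
  refine if_congr ?_ rfl rfl
  have := i.isLt
  have := j.isLt
  simp only [Equiv.Perm.mul_apply, Equiv.swap_apply_def, Fin.ext_iff, Finset.mem_insert,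
    Finset.mem_singleton]
  split_ifs <;> simp only [Fin.val_rev] at * <;> omega

theorem tMat_eq_permMatrix {k : ℕ} (hk : k < ℓ) :
    tMat ℓ (k + 1) =
      (Equiv.swap (⟨k, by omega⟩ : Fin (2 * ℓ)) (Fin.rev ⟨k, by omega⟩)).permMatrix ℂ := by
  ext i j
  rw [permMatrix_apply, tMat, Matrix.of_apply]
  refine if_congr ?_ rfl rfl
  have := i.isLt
  have := j.isLt
  simp only [Equiv.swap_apply_def, Fin.ext_iff, Finset.mem_insert, Finset.mem_singleton]
  split_ifs <;> simp only [Fin.val_rev] at * <;> omega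

theorem prod_sMat_mul_tMat {o a : ℕ} (h : o + (a + 1) ≤ ℓ) :
    ((List.range a).map fun i => sMat ℓ (o + i + 1)).prod * tMat ℓ (o + (a + 1)) =
      (signedCycle Fin.revPerm (block ℓ o (a + 1)))⁻¹.permMatrix ℂ := by
  induction a generalizing o with
  | zero =>
    have hblock : block ℓ o 1 = [⟨o, by omega⟩] := block_succ (by omega)
    rw [hblock, signedCycle_singleton, Equiv.swap_inv, List.range_zero, List.map_nil,
      List.prod_nil, one_mul, zero_add, tMat_eq_permMatrix (by omega)]
    rfl
  | succ a ih =>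
    have hshift : (fun i => sMat ℓ (o + i + 1)) ∘ Nat.succ = fun i => sMat ℓ (o + 1 + i + 1) := by
      funext i
      rw [Function.comp_apply, Nat.succ_eq_add_one, add_comm i 1, add_assoc o 1 i]
    have hblock : block ℓ o (a + 1 + 1) =
        ⟨o, by omega⟩ :: ⟨o + 1, by omega⟩ :: block ℓ (o + 1 + 1) a := by
      rw [block_succ (by omega), block_succ (by omega)]
    rw [hblock, signedCycle_cons_cons (hblock ▸ nodup_block_append_map_rev h),
      ← block_succ, _root_.mul_inv_rev, _root_.mul_inv_rev, Equiv.swap_inv, Equiv.swap_inv,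
      permMatrix_mul, ← ih (by omega), List.range_succ_eq_map, List.map_cons, List.prod_cons,
      List.map_map, hshift, mul_assoc, add_zero, sMat_eq_permMatrix (by omega), add_assoc o 1,
      add_comm 1 (a + 1)]
    rfl

end Block

section BlockPerm

variable {ℓ : ℕ}

/-- The permutation of the rows that underlies the product of the factors of `nMat` for the parts
in a list, where `o` is the sum of the parts already treated. -/
def blockPerm (ℓ : ℕ) : ℕ → List ℕ → Equiv.Perm (Fin (2 * ℓ))
  | _, [] => 1
  | o, a :: as => blockPerm ℓ (o + a) as * (signedCycle Fin.revPerm (block ℓ o a))⁻¹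

theorem blockProd_eq_permMatrix {L : List ℕ} {o : ℕ} (hL : ∀ a ∈ L, 0 < a)
    (h : o + L.sum ≤ ℓ) : blockProd ℓ o L = (blockPerm ℓ o L).permMatrix ℂ := by
  induction L generalizing o with
  | nil => simp [blockProd, blockPerm]
  | cons a L ih =>
    rw [List.forall_mem_cons] at hL
    rw [List.sum_cons] at h
    obtain ⟨b, rfl⟩ := Nat.exists_eq_succ_of_ne_zero hL.1.ne'
    rw [blockProd, blockPerm, permMatrix_mul, ← ih hL.2 (by omega),
      ← prod_sMat_mul_tMat (by omega)]
    rfl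

theorem commute_revPerm_blockPerm {L : List ℕ} {o : ℕ} (h : o + L.sum ≤ ℓ) :
    Commute Fin.revPerm (blockPerm ℓ o L) := by
  induction L generalizing o with
  | nil => exact Commute.one_right _
  | cons a L ih =>
    rw [List.sum_cons] at h
    have hrev : (Fin.revPerm * Fin.revPerm : Equiv.Perm (Fin (2 * ℓ))) = 1 := by ext i; simp
    exact (ih (by omega)).mul_right
      (commute_signedCycle hrev (nodup_block_append_map_rev (by omega))).inv_right

theorem le_of_blockPerm_apply_ne {L : List ℕ} {o : ℕ} (h : o + L.sum ≤ ℓ) {i : Fin (2 * ℓ)}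
    (hi : blockPerm ℓ o L i ≠ i) : o ≤ (i : ℕ) ∧ o ≤ (i.rev : ℕ) := by
  induction L generalizing o with
  | nil => exact absurd rfl hi
  | cons a L ih =>
    rw [List.sum_cons] at h
    by_cases hcycle : signedCycle Fin.revPerm (block ℓ o a) i = i
    · rw [blockPerm, Equiv.Perm.mul_apply, Equiv.Perm.inv_eq_iff_eq.2 hcycle.symm] at hi
      have := ih (by omega) hi
      omega
    · have := (mem_block_append_map_rev (by omega)).1 (mem_of_signedCycle_apply_ne hcycle)
      have := i.isLt
      simp only [Fin.val_rev] at *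
      omega

theorem cycleType_blockPerm {L : List ℕ} {o : ℕ} (hL : ∀ a ∈ L, 0 < a) (h : o + L.sum ≤ ℓ) :
    (blockPerm ℓ o L).cycleType = (L.map (2 * ·) : List ℕ) := by
  induction L generalizing o with
  | nil => simp [blockPerm]
  | cons a L ih =>
    rw [List.forall_mem_cons] at hL
    rw [List.sum_cons] at h
    have hlength : (block ℓ o a).length = a := length_block (by omega)
    have hne : block ℓ o a ≠ [] := List.ne_nil_of_length_pos (by rw [hlength]; exact hL.1)
    have hdisjoint :
        (blockPerm ℓ (o + a) L).Disjoint (signedCycle Fin.revPerm (block ℓ o a))⁻¹ := by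
      rw [Equiv.Perm.disjoint_inv_right_iff]
      intro i
      by_contra! hi
      have := le_of_blockPerm_apply_ne (by omega) hi.1
      have := (mem_block_append_map_rev (by omega)).1 (mem_of_signedCycle_apply_ne hi.2)
      omega
    rw [blockPerm, hdisjoint.cycleType_mul, ih hL.2 (by omega), Equiv.Perm.cycleType_inv,
      cycleType_signedCycle hne (nodup_block_append_map_rev (by omega)), hlength, add_comm]
    rfl

end BlockPerm

section NPerm

variable {ℓ : ℕ} (p : Nat.Partition ℓ)

/-- The permutation whose matrix is `nMat p`. -/
def nPerm : Equiv.Perm (Fin (2 * ℓ)) := blockPerm ℓ 0 (p.parts.sort (· ≤ ·))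

theorem sum_sort_parts : (p.parts.sort (· ≤ ·)).sum = ℓ := by
  rw [← Multiset.sum_coe, Multiset.sort_eq, p.parts_sum]

theorem pos_of_mem_sort_parts : ∀ a ∈ p.parts.sort (· ≤ ·), 0 < a :=
  fun _ ha => p.parts_pos ((Multiset.mem_sort _).1 ha)

theorem nMat_eq_permMatrix : nMat p = (nPerm p).permMatrix ℂ :=
  blockProd_eq_permMatrix (pos_of_mem_sort_parts p) (by rw [sum_sort_parts, zero_add])

theorem commute_revPerm_nPerm : Commute Fin.revPerm (nPerm p) :=
  commute_revPerm_blockPerm (by rw [sum_sort_parts, zero_add])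

theorem cycleType_nPerm : (nPerm p).cycleType = p.parts.map (2 * ·) := by
  rw [nPerm, cycleType_blockPerm (pos_of_mem_sort_parts p) (by rw [sum_sort_parts, zero_add]),
    ← Multiset.map_coe, Multiset.sort_eq]

theorem nMat_mem_SO (hp : Even p.parts.card) : nMat p ∈ SO ℓ := by
  rw [nMat_eq_permMatrix]
  refine permMatrix_mem_SO (commute_revPerm_nPerm p) ?_
  rw [Equiv.Perm.sign_of_cycleType, cycleType_nPerm, Multiset.sum_map_mul_left,
    Multiset.card_map]
  exact ((even_two_mul _).add hp).neg_one_pow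

theorem lcm_map_two_mul {s : Multiset ℕ} (hs : s ≠ 0) : (s.map (2 * ·)).lcm = 2 * s.lcm := by
  induction s using Multiset.induction_on with
  | empty => exact absurd rfl hs
  | cons a s ih =>
    rcases eq_or_ne s 0 with rfl | hs
    · simp
    · rw [Multiset.map_cons, Multiset.lcm_cons, Multiset.lcm_cons, ih hs]
      exact Nat.lcm_mul_left 2 a s.lcm

theorem parts_ne_zero (hl : ℓ ≠ 0) : p.parts ≠ 0 :=
  fun h => hl (by rw [← p.parts_sum, h, Multiset.sum_zero])

theorem orderOf_nMat (hl : ℓ ≠ 0) : orderOf (nMat p) = mOf p := by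
  rw [nMat_eq_permMatrix, orderOf_permMatrix, ← Equiv.Perm.lcm_cycleType, cycleType_nPerm,
    lcm_map_two_mul (parts_ne_zero p hl), mOf]

theorem mOf_pos : 0 < mOf p :=
  Nat.mul_pos two_pos <| Nat.pos_of_ne_zero fun h =>
    (p.parts_pos ((Multiset.lcm_eq_zero_iff _).1 h)).ne' rfl

theorem charpoly_nMat :
    (nMat p).charpoly = (p.parts.map fun q => (X ^ (2 * q) - 1 : ℂ[X])).prod := by
  have hsupport : (nPerm p).support.card = 2 * ℓ := by
    rw [← Equiv.Perm.sum_cycleType, cycleType_nPerm, Multiset.sum_map_mul_left, Multiset.map_id',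
      p.parts_sum]
  rw [nMat_eq_permMatrix, charpoly_permMatrix, Equiv.Perm.parts_partition, hsupport,
    Fintype.card_fin, Nat.sub_self, Multiset.replicate_zero, add_zero, cycleType_nPerm,
    Multiset.map_map]
  rfl

end NPerm

section ReciprocalPair

variable {K : Type*} [Field K]

/-- The monic polynomial with the roots `u` and `u⁻¹`. -/
noncomputable def reciprocalPair (u : K) : K[X] := (X - C u) * (X - C u⁻¹)

theorem reciprocalPair_one : reciprocalPair (1 : K) = (X - 1) ^ 2 := by
  rw [reciprocalPair, inv_one, C_1, sq]

theorem reciprocalPair_neg_one : reciprocalPair (-1 : K) = (X + 1) ^ 2 := by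
  rw [reciprocalPair, inv_neg_one, C_neg, C_1, sub_neg_eq_add, sq]

theorem X_pow_sub_one_eq_prod_range {N : ℕ} {ζ : K} (hζ : IsPrimitiveRoot ζ N) (hN : 0 < N) :
    (X ^ N - 1 : K[X]) = ∏ k ∈ Finset.range N, (X - C (ζ ^ k)) := by
  rw [X_pow_sub_one_eq_prod hN hζ]
  refine (Finset.prod_nbij (ζ ^ ·) (fun k _ => ?_) (fun a ha b hb hab => ?_) (fun z hz => ?_)
    fun _ _ => rfl).symm
  · rw [mem_nthRootsFinset hN, pow_right_comm, hζ.pow_eq_one, one_pow]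
  · exact hζ.pow_inj (Finset.mem_range.1 ha) (Finset.mem_range.1 hb) hab
  · have := NeZero.of_pos hN
    obtain ⟨k, hk, rfl⟩ := hζ.eq_pow_of_pow_eq_one ((mem_nthRootsFinset hN _).1 hz)
    exact ⟨k, Finset.mem_coe.2 (Finset.mem_range.2 hk), rfl⟩

theorem X_pow_two_mul_sub_one {q : ℕ} (hq : 0 < q) {ζ : K} (hζ : IsPrimitiveRoot ζ (2 * q)) :
    (X ^ (2 * q) - 1 : K[X]) =
      (X - 1) * (X + 1) * ∏ a ∈ Finset.Icc 1 (q - 1), reciprocalPair (ζ ^ a) := by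
  obtain ⟨b, rfl⟩ := Nat.exists_eq_succ_of_ne_zero hq.ne'
  have hneg : ζ ^ (b + 1) = -1 :=
    (hζ.pow (by omega) (mul_comm 2 (b + 1))).eq_neg_one_of_two_right
  have hIcc : ∏ a ∈ Finset.Icc 1 b, reciprocalPair (ζ ^ a) =
      ∏ k ∈ Finset.range b, reciprocalPair (ζ ^ (k + 1)) := by
    rw [← Finset.Ico_add_one_right_eq_Icc, Finset.prod_Ico_eq_prod_range, Nat.add_sub_cancel]
    simp only [add_comm]
  have hreflect : ∏ k ∈ Finset.range b, (X - C (ζ ^ (b + 1 + (k + 1)))) =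
      ∏ k ∈ Finset.range b, (X - C (ζ ^ (k + 1))⁻¹) := by
    rw [← Finset.prod_range_reflect]
    refine Finset.prod_congr rfl fun k hk => ?_
    have hk := Finset.mem_range.1 hk
    have hsum : b + 1 + (b - 1 - k + 1) + (k + 1) = 2 * (b + 1) := by omega
    have hinv : ζ ^ (b + 1 + (b - 1 - k + 1)) * ζ ^ (k + 1) = 1 := by
      rw [← pow_add, hsum, hζ.pow_eq_one]
    rw [eq_inv_of_mul_eq_one_left hinv]
  rw [X_pow_sub_one_eq_prod_range hζ (by omega), two_mul, Finset.prod_range_add,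
    Finset.prod_range_succ', Finset.prod_range_succ' _ b, hreflect, Nat.succ_sub_one, hIcc,
    add_zero, hneg, pow_zero, C_neg, C_1]
  simp only [reciprocalPair, Finset.prod_mul_distrib]
  ring

theorem roots_prod_reciprocalPair {ι : Type*} [Fintype ι] (u : ι → K) :
    (∏ i, reciprocalPair (u i)).roots =
      Finset.univ.val.map u + Finset.univ.val.map fun i => (u i)⁻¹ := by
  rw [← roots_multiset_prod_X_sub_C (_ + _), Multiset.map_add, Multiset.prod_add,
    Multiset.map_map, Multiset.map_map]
  exact congrArg roots Finset.prod_mul_distrib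

/-- The families agree up to a permutation and inversions because `z + z⁻¹` determines `z` up to
inversion. -/
theorem exists_perm_of_prod_reciprocalPair_eq {ι : Type*} [Fintype ι] {u v : ι → K}
    (hu : ∀ i, u i ≠ 0) (hv : ∀ i, v i ≠ 0)
    (h : ∏ i, reciprocalPair (u i) = ∏ i, reciprocalPair (v i)) :
    ∃ τ : Equiv.Perm ι, ∀ i, u i = v (τ i) ∨ u i * v (τ i) = 1 := by
  have htrace (w : ι → K) : (∏ i, reciprocalPair (w i)).roots.map (fun z => z + z⁻¹) =
      2 • Finset.univ.val.map fun i => w i + (w i)⁻¹ := by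
    rw [roots_prod_reciprocalPair, Multiset.map_add, Multiset.map_map, Multiset.map_map, two_nsmul]
    simp only [Function.comp_def, inv_inv, add_comm]
  have heq : Finset.univ.val.map (fun i => u i + (u i)⁻¹) =
      Finset.univ.val.map fun i => v i + (v i)⁻¹ := by
    refine nsmul_right_injective two_ne_zero ?_
    simp only [← htrace, h]
  obtain ⟨τ, hτ⟩ := exists_perm_of_map_univ_eq heq
  refine ⟨τ, fun i => ?_⟩
  have hui := hu i
  have hvi := hv (τ i)
  have htr := hτ i
  have hfactor : (u i - v (τ i)) * (u i * v (τ i) - 1) = 0 := by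
    field_simp at htr
    linear_combination htr
  simpa only [mul_eq_zero, sub_eq_zero] using hfactor

end ReciprocalPair

section CocharCharpoly

variable {ℓ : ℕ}

theorem prod_fin_two_mul {M : Type*} [CommMonoid M] (F G : Fin ℓ → M) :
    (∏ i : Fin (2 * ℓ), if h : (i : ℕ) < ℓ then F ⟨i, h⟩ else G ⟨2 * ℓ - 1 - i, by omega⟩) =
      ∏ i, F i * G i := by
  rw [← Fin.prod_congr' _ (two_mul ℓ).symm, Fin.prod_univ_add, Finset.prod_mul_distrib]
  congr 1
  · refine Finset.prod_congr rfl fun i _ => ?_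
    rw [dif_pos (by simp)]
    rfl
  · rw [← Equiv.prod_comp Fin.revPerm]
    refine Finset.prod_congr rfl fun i _ => ?_
    rw [dif_neg (by simp)]
    congr 1
    ext
    simp only [Fin.val_cast, Fin.val_natAdd, Fin.revPerm_apply, Fin.val_rev]
    omega

theorem charpoly_cochar (lam : Fin ℓ → ℤ) (z : ℂ) :
    (cochar lam z).charpoly = ∏ i, reciprocalPair (z ^ lam i) := by
  simp only [cochar, charpoly_diagonal, reciprocalPair, ← prod_fin_two_mul]
  refine Finset.prod_congr rfl fun i _ => ?_
  split_ifs
  · rfl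
  · rw [_root_.zpow_neg]

theorem exists_perm_of_charpoly_cochar_eq {m : ℕ} {lam μ : Fin ℓ → ℤ} {ξ : ℂ}
    (hξ : IsPrimitiveRoot ξ m) (hm : m ≠ 0)
    (h : (cochar lam ξ).charpoly = (cochar μ ξ).charpoly) :
    ∃ τ : Equiv.Perm (Fin ℓ), ∀ i, (m : ℤ) ∣ lam i - μ (τ i) ∨ (m : ℤ) ∣ lam i + μ (τ i) := by
  have hξ0 : ξ ≠ 0 := hξ.ne_zero hm
  have hne (μ : Fin ℓ → ℤ) (i : Fin ℓ) : ξ ^ μ i ≠ 0 := zpow_ne_zero _ hξ0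
  rw [charpoly_cochar, charpoly_cochar] at h
  obtain ⟨τ, hτ⟩ := exists_perm_of_prod_reciprocalPair_eq (hne lam) (hne μ) h
  refine ⟨τ, fun i => (hτ i).imp (fun hi => ?_) fun hi => ?_⟩
  · rw [← hξ.zpow_eq_one_iff_dvd, zpow_sub₀ hξ0, hi, div_self (hne μ _)]
  · rw [← hξ.zpow_eq_one_iff_dvd, zpow_add₀ hξ0, hi]

end CocharCharpoly

section Sigma

variable {ℓ : ℕ} (p : Nat.Partition ℓ)

/-- The cocharacter with the coordinates `σ_1, …, σ_ℓ`. -/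
def sigmaVec : Fin ℓ → ℤ := fun i => σ p (i + 1)

variable {p}

theorem map_univ_getD {α : Type*} {L : List α} {n : ℕ} (h : L.length = n) (d : α) :
    (Finset.univ : Finset (Fin n)).val.map (fun i : Fin n => L.getD i d) = L := by
  subst h
  simp [Fin.univ_val_map]

theorem map_sigmaVec (hp : Even p.parts.card) :
    Finset.univ.val.map (sigmaVec p) = (entries p).map fun n : ℕ => (n : ℤ) := by
  have hlength : ((entries p).sort (· ≥ ·)).length = ℓ := by
    rw [Multiset.length_sort, card_entries p hp]
  have h := congrArg (Multiset.map fun n : ℕ => (n : ℤ)) (map_univ_getD hlength 0)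
  rw [Multiset.sort_eq, Multiset.map_map] at h
  exact h

theorem exists_sigmaVec_eq_iff (hp : Even p.parts.card) {z : ℤ} :
    (∃ i, sigmaVec p i = z) ↔ ∃ n ∈ entries p, (n : ℤ) = z := by
  have h : z ∈ Finset.univ.val.map (sigmaVec p) ↔ z ∈ (entries p).map fun n : ℕ => (n : ℤ) := by
    rw [map_sigmaVec hp]
  simpa using h

theorem two_mul_dvd_mOf {q : ℕ} (hq : q ∈ p.parts) : 2 * q ∣ mOf p :=
  mul_dvd_mul_left 2 (Multiset.dvd_lcm hq)

theorem two_mul_le_of_mem_entries {n : ℕ} (hn : n ∈ entries p) : 2 * n ≤ mOf p := by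
  rw [entries, Multiset.mem_add, Multiset.mem_add, Multiset.mem_bind] at hn
  rcases hn with (⟨q, hq, hn⟩ | hn) | hn
  · obtain ⟨a, ha, rfl⟩ := Multiset.mem_map.1 hn
    have haq := Finset.mem_Icc.1 (Finset.mem_def.2 ha)
    obtain ⟨t, ht⟩ := two_mul_dvd_mOf hq
    rw [ht, mul_left_comm, Nat.mul_div_cancel_left _ (by omega), mul_assoc]
    exact Nat.mul_le_mul_left 2 (Nat.mul_le_mul_right t (by omega))
  · rw [Multiset.eq_of_mem_replicate hn]
    omega
  · rw [Multiset.eq_of_mem_replicate hn]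
    omega

theorem sigmaVec_nonneg (i : Fin ℓ) : 0 ≤ sigmaVec p i := Int.natCast_nonneg _

theorem two_mul_sigmaVec_le (hp : Even p.parts.card) (i : Fin ℓ) :
    2 * sigmaVec p i ≤ mOf p := by
  obtain ⟨n, hn, hi⟩ := (exists_sigmaVec_eq_iff hp).1 ⟨i, rfl⟩
  have := two_mul_le_of_mem_entries hn
  omega

theorem sigmaVec_antitone : Antitone (sigmaVec p) := by
  intro i j hij
  rcases hij.eq_or_lt with rfl | hij
  · exact le_rfl
  simp only [sigmaVec, σ, Nat.add_sub_cancel, Nat.cast_le]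
  set L := (entries p).sort (· ≥ ·)
  by_cases hj : (j : ℕ) < L.length
  · rw [List.getD_eq_getElem _ _ hj, List.getD_eq_getElem _ _ (lt_trans hij hj)]
    exact List.pairwise_iff_getElem.1 (Multiset.pairwise_sort (entries p) (· ≥ ·)) i j _ _ hij
  · rw [List.getD_eq_default _ _ (not_lt.1 hj)]
    exact Nat.zero_le _

theorem card_parts_div_two_ne_zero (hl : ℓ ≠ 0) (hp : Even p.parts.card) :
    p.parts.card / 2 ≠ 0 := by
  have hpos := Multiset.card_pos.2 (parts_ne_zero p hl)
  obtain ⟨c, hc⟩ := hp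
  omega

theorem sigmaVec_last (hl : 0 < ℓ) (hp : Even p.parts.card) :
    sigmaVec p ⟨ℓ - 1, by omega⟩ = 0 := by
  have hzero : 0 ∈ entries p := Multiset.mem_add.2
    (.inr (Multiset.mem_replicate.2 ⟨card_parts_div_two_ne_zero hl.ne' hp, rfl⟩))
  obtain ⟨i, hi⟩ := (exists_sigmaVec_eq_iff hp).2 ⟨0, hzero, rfl⟩
  refine le_antisymm ((sigmaVec_antitone ?_).trans_eq hi) (sigmaVec_nonneg _)
  exact Nat.le_sub_one_of_lt i.isLt

theorem two_mul_sigmaVec_zero (hl : 0 < ℓ) (hp : Even p.parts.card) :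
    2 * sigmaVec p ⟨0, hl⟩ = mOf p := by
  have hhalf : mOf p / 2 ∈ entries p := Multiset.mem_add.2 (.inl (Multiset.mem_add.2
    (.inr (Multiset.mem_replicate.2 ⟨card_parts_div_two_ne_zero hl.ne' hp, rfl⟩))))
  have heven : 2 * (mOf p / 2) = mOf p := Nat.mul_div_cancel' (dvd_mul_right 2 _)
  obtain ⟨i, hi⟩ := (exists_sigmaVec_eq_iff hp).2 ⟨_, hhalf, rfl⟩
  have hle : sigmaVec p i ≤ sigmaVec p ⟨0, hl⟩ := sigmaVec_antitone (Nat.zero_le _)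
  have := two_mul_sigmaVec_le hp ⟨0, hl⟩
  omega

theorem charpoly_cochar_sigmaVec (hp : Even p.parts.card) (z : ℂ) :
    (cochar (sigmaVec p) z).charpoly =
      ((entries p).map fun n => reciprocalPair (z ^ n)).prod := by
  have h := congrArg (fun s => (s.map fun n : ℤ => reciprocalPair (z ^ n)).prod) (map_sigmaVec hp)
  simpa only [charpoly_cochar, Finset.prod, Multiset.map_map, Function.comp_def, zpow_natCast]
    using h

theorem X_pow_two_mul_sub_one_of_dvd {K : Type*} [Field K] {m q : ℕ} {ξ : K}
    (hξ : IsPrimitiveRoot ξ m) (hm : 0 < m) (hq : 2 * q ∣ m) :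
    (X ^ (2 * q) - 1 : K[X]) = (X - 1) * (X + 1) *
      ((Finset.Icc 1 (q - 1)).val.map fun a => reciprocalPair (ξ ^ (a * m / (2 * q)))).prod := by
  have hq0 : 0 < q := by have := Nat.pos_of_dvd_of_pos hq hm; omega
  obtain ⟨t, ht⟩ := hq
  have hexp (a : ℕ) : a * m / (2 * q) = t * a := by
    rw [ht, mul_left_comm, Nat.mul_div_cancel_left _ (by omega), mul_comm]
  rw [X_pow_two_mul_sub_one hq0 (hξ.pow hm (ht.trans (mul_comm _ _)))]
  simp only [hexp, pow_mul, Finset.prod]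

theorem charpoly_nMat_eq_charpoly_cochar (hp : Even p.parts.card) {ξ : ℂ}
    (hξ : IsPrimitiveRoot ξ (mOf p)) : (nMat p).charpoly = (cochar (sigmaVec p) ξ).charpoly := by
  have hhalf : ξ ^ (mOf p / 2) = -1 := (hξ.pow (mOf_pos p)
    (Nat.div_mul_cancel (dvd_mul_right 2 _)).symm).eq_neg_one_of_two_right
  have hparts := Multiset.map_congr rfl fun q (hq : q ∈ p.parts) =>
    X_pow_two_mul_sub_one_of_dvd hξ (mOf_pos p) (two_mul_dvd_mOf hq)
  rw [charpoly_nMat, hparts, Multiset.prod_map_mul, Multiset.map_const', Multiset.prod_replicate,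
    charpoly_cochar_sigmaVec hp, entries]
  simp only [Multiset.map_add, Multiset.prod_add, Multiset.map_replicate, Multiset.prod_replicate,
    Multiset.map_bind, Multiset.prod_bind, Multiset.map_map, Function.comp_def, hhalf, pow_zero,
    reciprocalPair_one, reciprocalPair_neg_one]
  rw [← pow_mul, ← pow_mul, Nat.mul_div_cancel' hp.two_dvd, mul_pow]
  ring

end Sigma

section Alcove

variable {ℓ : ℕ}

/-- The points `v` at which every positive root `α` of `D_ℓ` satisfies `0 ≤ α(v) ≤ c`. For `c = 1`
this is the closure of the fundamental alcove; with an integral `c` one can speak about cocharacters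
without dividing by their denominator. -/
def dilatedAlcove {R : Type*} [AddGroup R] [Preorder R] (ℓ : ℕ) (c : R) : Set (Fin ℓ → R) :=
  {v | ∀ i j, i < j → v i - v j ∈ Set.Icc 0 c ∧ v i + v j ∈ Set.Icc 0 c}

theorem closure_setOf_dotProduct_mem_Ioo {ι : Type*} [Fintype ι] {Φ : Set (ι → ℝ)} {a b : ℝ}
    {c : ι → ℝ} (hc : ∀ α ∈ Φ, α ⬝ᵥ c ∈ Set.Ioo a b) :
    closure {v | ∀ α ∈ Φ, α ⬝ᵥ v ∈ Set.Ioo a b} = {v | ∀ α ∈ Φ, α ⬝ᵥ v ∈ Set.Icc a b} := by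
  refine Set.Subset.antisymm (closure_minimal ?_ ?_) fun v hv => ?_
  · exact fun v hv α hα => Set.Ioo_subset_Icc_self (hv α hα)
  · simp only [Set.ofPred_forall]
    exact isClosed_biInter fun α _ => isClosed_Icc.preimage (by fun_prop)
  · have hsegment : openSegment ℝ v c ⊆ {v | ∀ α ∈ Φ, α ⬝ᵥ v ∈ Set.Ioo a b} := by
      rintro _ ⟨s, t, hs, ht, hst, rfl⟩ α hα
      obtain ⟨hva, hvb⟩ := hv α hα
      obtain ⟨hca, hcb⟩ := hc α hα
      obtain rfl : s = 1 - t := by linarith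
      rw [dotProduct_add, dotProduct_smul, dotProduct_smul, smul_eq_mul, smul_eq_mul]
      constructor <;> nlinarith
    exact closure_mono hsegment (segment_subset_closure_openSegment (left_mem_segment ℝ v c))

theorem e_dotProduct (i : Fin ℓ) (v : Fin ℓ → ℝ) : e i ⬝ᵥ v = v i := by
  rw [e, single_dotProduct, one_mul]

theorem forall_mem_posRoots_dotProduct_mem_iff {S : Set ℝ} {v : Fin ℓ → ℝ} :
    (∀ α ∈ posRoots ℓ, α ⬝ᵥ v ∈ S) ↔ ∀ i j, i < j → v i - v j ∈ S ∧ v i + v j ∈ S := by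
  refine ⟨fun h i j hij => ⟨?_, ?_⟩, ?_⟩
  · simpa only [sub_dotProduct, e_dotProduct] using h _ ⟨i, j, hij, .inl rfl⟩
  · simpa only [add_dotProduct, e_dotProduct] using h _ ⟨i, j, hij, .inr rfl⟩
  · rintro h _ ⟨i, j, hij, rfl | rfl⟩
    · simpa only [sub_dotProduct, e_dotProduct] using (h i j hij).1
    · simpa only [add_dotProduct, e_dotProduct] using (h i j hij).2

theorem alcove_nonempty (ℓ : ℕ) : (alcove ℓ).Nonempty := by
  refine ⟨fun i => (ℓ - i) / (2 * ℓ),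
    (forall_mem_posRoots_dotProduct_mem_iff (S := Set.Ioo 0 1)).2 fun i j hij => ?_⟩
  have : (0 : ℝ) ≤ (i : ℕ) := Nat.cast_nonneg _
  have hj : ((i : ℕ) : ℝ) + 1 ≤ (j : ℕ) := by exact_mod_cast hij
  have hjℓ : ((j : ℕ) : ℝ) + 1 ≤ ℓ := by exact_mod_cast j.isLt
  have hℓ : (0 : ℝ) < 2 * ℓ := by linarith
  simp only [← sub_div, ← add_div, Set.mem_Ioo, div_lt_one hℓ, div_pos_iff_of_pos_right hℓ]
  refine ⟨⟨?_, ?_⟩, ?_, ?_⟩ <;> linarith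

theorem closure_alcove (ℓ : ℕ) : closure (alcove ℓ) = dilatedAlcove ℓ (1 : ℝ) := by
  obtain ⟨c, hc⟩ := alcove_nonempty ℓ
  exact (closure_setOf_dotProduct_mem_Ioo hc).trans
    (Set.ext fun v => forall_mem_posRoots_dotProduct_mem_iff)

theorem div_mem_dilatedAlcove_one_iff {lam : Fin ℓ → ℤ} {m : ℕ} (hm : 0 < m) :
    (fun i => (lam i : ℝ) / m) ∈ dilatedAlcove ℓ (1 : ℝ) ↔ lam ∈ dilatedAlcove ℓ (m : ℤ) := by
  have hmR : (0 : ℝ) < m := Nat.cast_pos.2 hm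
  simp only [dilatedAlcove, Set.mem_ofPred_eq, Set.mem_Icc, ← sub_div, ← add_div, div_le_one hmR,
    le_div_iff₀ hmR, zero_mul]
  norm_cast

end Alcove

section Labels

variable {ℓ : ℕ}

theorem simpleRoot_dotProduct (k : Fin ℓ) (v : Fin ℓ → ℝ) : simpleRoot k ⬝ᵥ v =
    if h : (k : ℕ) + 1 < ℓ then v k - v ⟨k + 1, h⟩ else v ⟨k - 1, by omega⟩ + v k := by
  unfold simpleRoot
  split_ifs
  · rw [sub_dotProduct, e_dotProduct, e_dotProduct]
  · rw [add_dotProduct, e_dotProduct, e_dotProduct]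

theorem sum_smul_coweight_eq_iff (hl : 4 ≤ ℓ) {a v : Fin ℓ → ℝ} :
    ∑ k, a k • coweight k = v ↔ ∀ k, a k = simpleRoot k ⬝ᵥ v := by
  let A : Matrix (Fin ℓ) (Fin ℓ) ℝ := of simpleRoot
  let W : Matrix (Fin ℓ) (Fin ℓ) ℝ := of coweight
  have hAW : A * Wᵀ = 1 := by
    ext j k
    rw [one_apply, ← simpleRoot_dotProduct_coweight hl j k]
    rfl
  have hsum : ∑ k, a k • coweight k = Wᵀ *ᵥ a := by
    rw [mulVec_transpose, vecMul_eq_sum]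
    rfl
  rw [hsum]
  constructor
  · rintro rfl k
    have := congrFun (mulVec_mulVec a A Wᵀ) k
    rw [hAW, one_mulVec] at this
    exact this.symm
  · intro h
    obtain rfl : a = A *ᵥ v := funext h
    rw [mulVec_mulVec, mul_eq_one_comm.1 hAW, one_mulVec]

/-- The integers `s_γ` attached to the cocharacter `lam` and the order `m`: the coordinates of
`lam` with respect to the fundamental coweights, and on `γ_0` the difference of `m` and the
value of the highest root. -/
def kacLabels (hl : 2 ≤ ℓ) (m : ℤ) (lam : Fin ℓ → ℤ) : Fin (ℓ + 1) → ℤ :=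
  Fin.cons (m - (lam ⟨0, by omega⟩ + lam ⟨1, by omega⟩)) fun k =>
    if h : (k : ℕ) + 1 < ℓ then lam k - lam ⟨k + 1, h⟩ else lam ⟨k - 1, by omega⟩ + lam k

theorem kacLabels_succ (hl : 2 ≤ ℓ) (m : ℤ) (lam : Fin ℓ → ℤ) (k : Fin ℓ) :
    (kacLabels hl m lam k.succ : ℝ) = simpleRoot k ⬝ᵥ fun i => (lam i : ℝ) := by
  rw [simpleRoot_dotProduct, kacLabels, Fin.cons_succ]
  split_ifs <;> push_cast <;> rfl

theorem kacLabels_nonneg (hl : 2 ≤ ℓ) {m : ℤ} {lam : Fin ℓ → ℤ} (h : lam ∈ dilatedAlcove ℓ m)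
    (k : Fin (ℓ + 1)) : 0 ≤ kacLabels hl m lam k := by
  induction k using Fin.cases with
  | zero => exact sub_nonneg.2 (h _ _ (Fin.mk_lt_mk.2 zero_lt_one)).2.2
  | succ k =>
    rw [kacLabels, Fin.cons_succ]
    split_ifs with hk
    · exact (h k ⟨k + 1, hk⟩ (Nat.lt_succ_self _)).1.1
    · exact (h ⟨k - 1, _⟩ k (Fin.lt_def.2 (by dsimp only; omega))).2.1

theorem sum_mul_mark (hl : 4 ≤ ℓ) {s : Fin (ℓ + 1) → ℤ} {lam : Fin ℓ → ℤ}
    (h : ∑ k : Fin ℓ, (s k.succ : ℝ) • coweight k = fun i => (lam i : ℝ)) :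
    ∑ k, s k * (mark k : ℤ) = s 0 + (lam ⟨0, by omega⟩ + lam ⟨1, by omega⟩) := by
  have hpair := congrArg (fun w => (e ⟨0, by omega⟩ + e ⟨1, by omega⟩ : Fin ℓ → ℝ) ⬝ᵥ w) h
  simp only [dotProduct_sum, dotProduct_smul, highestRoot_dotProduct_coweight hl, smul_eq_mul,
    add_dotProduct, e_dotProduct] at hpair
  have hmark : mark (0 : Fin (ℓ + 1)) = 1 := by simp [mark]
  rw [Fin.sum_univ_succ, hmark, Nat.cast_one, mul_one]
  congr 1
  exact_mod_cast hpair

theorem eq_kacLabels_iff (hl : 4 ≤ ℓ) {m : ℕ} (hm : 0 < m) {lam : Fin ℓ → ℤ}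
    {s : Fin (ℓ + 1) → ℤ} :
    ((fun i => (lam i : ℝ) / m) = (1 / (m : ℝ)) • ∑ k : Fin ℓ, (s k.succ : ℝ) • coweight k ∧
      (m : ℤ) = ∑ k, s k * (mark k : ℤ)) ↔ s = kacLabels (by omega) m lam := by
  have hmR : (1 / (m : ℝ)) ≠ 0 := one_div_ne_zero (Nat.cast_ne_zero.2 hm.ne')
  have hdiv : (fun i => (lam i : ℝ) / m) = (1 / (m : ℝ)) • fun i => (lam i : ℝ) := by
    funext i
    simp [div_eq_inv_mul]
  rw [hdiv, (smul_right_injective (Fin ℓ → ℝ) hmR).eq_iff, eq_comm]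
  constructor
  · rintro ⟨hsum, hm⟩
    funext k
    induction k using Fin.cases with
    | zero =>
      rw [sum_mul_mark hl hsum] at hm
      exact eq_sub_of_add_eq hm.symm
    | succ k =>
      have hk := (sum_smul_coweight_eq_iff hl).1 hsum k
      rw [← kacLabels_succ (by omega) m] at hk
      exact_mod_cast hk
  · rintro rfl
    have hsum := (sum_smul_coweight_eq_iff hl).2 (kacLabels_succ (by omega) m lam)
    exact ⟨hsum, by rw [sum_mul_mark hl hsum]; exact (sub_add_cancel _ _).symm⟩

theorem isKacDiagram_iff_exists_cochar (hl : 4 ≤ ℓ) {g : Matrix (Fin (2 * ℓ)) (Fin (2 * ℓ)) ℂ}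
    {ξ : ℂ} {d : Fin (ℓ + 1) → ℤ} : IsKacDiagram ξ g d ↔
      g ∈ SO ℓ ∧ IsOfFinOrder g ∧ IsPrimitiveRoot ξ (orderOf g) ∧
      ∃ h ∈ SO ℓ, ∃ lam : Fin ℓ → ℤ, h⁻¹ * g * h = cochar lam ξ ∧
        lam ∈ dilatedAlcove ℓ (orderOf g : ℤ) ∧
        d = reduce (kacLabels (by omega) (orderOf g) lam) := by
  refine and_congr_right fun _ => and_congr_right fun hfin => and_congr_right fun _ => ?_
  have hm := hfin.orderOf_pos
  constructor
  · rintro ⟨h, hh, lam, x, s, hconj, hx, hxC, -, hxs, hms, rfl⟩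
    obtain rfl : x = fun i => (lam i : ℝ) / orderOf g := funext hx
    rw [closure_alcove, div_mem_dilatedAlcove_one_iff hm] at hxC
    rw [(eq_kacLabels_iff hl hm).1 ⟨hxs, hms⟩]
    exact ⟨h, hh, lam, hconj, hxC, rfl⟩
  · rintro ⟨h, hh, lam, hconj, hlam, rfl⟩
    obtain ⟨hxs, hms⟩ := (eq_kacLabels_iff hl hm (lam := lam)).2 rfl
    refine ⟨h, hh, lam, _, _, hconj, fun _ => rfl, ?_, kacLabels_nonneg _ hlam, hxs, hms, rfl⟩
    rwa [closure_alcove, div_mem_dilatedAlcove_one_iff hm]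

end Labels

section Uniqueness

variable {ℓ : ℕ} {m : ℤ} {lam μ : Fin ℓ → ℤ}

theorem antitone_of_mem_dilatedAlcove (h : lam ∈ dilatedAlcove ℓ m) : Antitone lam :=
  antitone_iff_forall_lt.2 fun i j hij => sub_nonneg.1 (h i j hij).1.1

theorem two_mul_le_of_mem_dilatedAlcove (hl : 3 ≤ ℓ) (hm : 0 < m) (h : lam ∈ dilatedAlcove ℓ m)
    {j : Fin ℓ} {t : ℤ} (hj : 2 * lam j = m * (2 * t + 1)) (i : Fin ℓ) : 2 * lam i ≤ m := by
  let first : Fin ℓ := ⟨0, by omega⟩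
  let second : Fin ℓ := ⟨1, by omega⟩
  let last : Fin ℓ := ⟨ℓ - 1, by omega⟩
  have hfs := h first second (Fin.mk_lt_mk.2 zero_lt_one)
  have hfl := h first last (Fin.mk_lt_mk.2 (by omega))
  have hsl := h second last (Fin.mk_lt_mk.2 (by omega))
  have hanti := antitone_of_mem_dilatedAlcove h
  have hi : lam i ≤ lam first := hanti (Nat.zero_le _)
  have hlast : lam last ≤ lam j := hanti (Nat.le_sub_one_of_lt j.isLt)
  have hfirst : lam j ≤ lam first := hanti (Nat.zero_le _)
  have hor : lam j = lam first ∨ lam j ≤ lam second :=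
    (Nat.eq_zero_or_pos (j : ℕ)).imp (fun h => congrArg lam (Fin.ext h)) fun h => hanti h
  simp only [Set.mem_Icc] at hfs hfl hsl
  have ht0 : -1 ≤ t := by
    by_contra! ht
    nlinarith
  have ht1 : t ≤ 0 := by
    by_contra! ht
    nlinarith
  obtain rfl | rfl : t = -1 ∨ t = 0 := by omega
  · omega
  · rcases hor with hor | hor <;> omega

theorem nonneg_of_mem_dilatedAlcove (hl : 2 ≤ ℓ) (hm : 0 < m) (h : lam ∈ dilatedAlcove ℓ m)
    (hle : ∀ i, 2 * lam i ≤ m) {j : Fin ℓ} (hj : m ∣ lam j) (i : Fin ℓ) : 0 ≤ lam i := by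
  let last : Fin ℓ := ⟨ℓ - 1, by omega⟩
  have hadd (i : Fin ℓ) (hi : i < last) : 0 ≤ lam i + lam last := (h i last hi).2.1
  have hanti := antitone_of_mem_dilatedAlcove h
  have hlast (i : Fin ℓ) : lam last ≤ lam i := hanti (Nat.le_sub_one_of_lt i.isLt)
  have hlt_or_eq (i : Fin ℓ) : i < last ∨ i = last :=
    lt_or_eq_of_le (Fin.le_def.2 (Nat.le_sub_one_of_lt i.isLt))
  have hneg : -m < lam last := by
    have := hadd ⟨0, by omega⟩ (Fin.mk_lt_mk.2 (by omega))
    have := hle ⟨0, by omega⟩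
    omega
  have hj0 : lam j = 0 := Int.eq_zero_of_abs_lt_dvd hj
    (abs_lt.2 ⟨hneg.trans_le (hlast j), by have := hle j; omega⟩)
  have hlast0 : 0 ≤ lam last := by
    rcases hlt_or_eq j with hlt | heq
    · simpa only [hj0, zero_add] using hadd j hlt
    · rw [← heq, hj0]
  exact hlast0.trans (hlast i)

theorem eq_of_dvd_sub_or_dvd_add {x y : ℤ} (hx : 0 ≤ x) (hxm : 2 * x ≤ m) (hy : 0 ≤ y)
    (hym : 2 * y ≤ m) (h : m ∣ x - y ∨ m ∣ x + y) : x = y := by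
  by_cases hm : x + y = m
  · omega
  rcases h with h | h
  · exact sub_eq_zero.1 (Int.eq_zero_of_abs_lt_dvd h (abs_lt.2 ⟨by omega, by omega⟩))
  · have := Int.eq_zero_of_abs_lt_dvd h (abs_lt.2 ⟨by omega, by omega⟩)
    omega

theorem nonneg_and_two_mul_le_of_antitone (hl : 0 < ℓ) (hμ : Antitone μ)
    (hlast : μ ⟨ℓ - 1, by omega⟩ = 0) (hfirst : 2 * μ ⟨0, hl⟩ = m) (i : Fin ℓ) :
    0 ≤ μ i ∧ 2 * μ i ≤ m :=
  ⟨hlast ▸ hμ (Nat.le_sub_one_of_lt i.isLt),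
    (mul_le_mul_of_nonneg_left (hμ (Nat.zero_le i)) zero_le_two).trans_eq hfirst⟩

theorem mem_dilatedAlcove_of_antitone (hμ : Antitone μ) (hbound : ∀ i, 0 ≤ μ i ∧ 2 * μ i ≤ m) :
    μ ∈ dilatedAlcove ℓ m := by
  intro i j hij
  have hi := hbound i
  have hj := hbound j
  have hanti := hμ hij.le
  simp only [Set.mem_Icc]
  omega

/-- Since `m / 2` and `0` occur among the entries of `μ`, the point `lam` is a fixed point of the
automorphisms of the alcove that interchange `γ_0, γ_1` and `γ_{ℓ-1}, γ_ℓ`, so that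
`0 ≤ lam i ≤ m / 2`. -/
theorem eq_of_mem_dilatedAlcove (hl : 3 ≤ ℓ) (hm : 0 < m) (hlam : lam ∈ dilatedAlcove ℓ m)
    (hμ : Antitone μ) (hlast : μ ⟨ℓ - 1, by omega⟩ = 0) (hfirst : 2 * μ ⟨0, by omega⟩ = m)
    {τ : Equiv.Perm (Fin ℓ)} (h : ∀ i, m ∣ lam i - μ (τ i) ∨ m ∣ lam i + μ (τ i)) : lam = μ := by
  have hlam_le : ∀ i, 2 * lam i ≤ m := by
    have hj := h (τ.symm ⟨0, by omega⟩)
    rw [Equiv.apply_symm_apply] at hj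
    rcases hj with ⟨t, ht⟩ | ⟨t, ht⟩
    · exact two_mul_le_of_mem_dilatedAlcove hl hm hlam (t := t)
        (by linear_combination 2 * ht + hfirst)
    · exact two_mul_le_of_mem_dilatedAlcove hl hm hlam (t := t - 1)
        (by linear_combination 2 * ht - hfirst)
  have hlam_nonneg : ∀ i, 0 ≤ lam i := by
    have hj := h (τ.symm ⟨ℓ - 1, by omega⟩)
    rw [Equiv.apply_symm_apply, hlast, sub_zero, add_zero, or_self] at hj
    exact nonneg_of_mem_dilatedAlcove (by omega) hm hlam hlam_le hj
  obtain rfl : lam = μ ∘ τ := funext fun i =>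
    have ⟨hμ_nonneg, hμ_le⟩ := nonneg_and_two_mul_le_of_antitone (by omega) hμ hlast hfirst (τ i)
    eq_of_dvd_sub_or_dvd_add (hlam_nonneg i) (hlam_le i) hμ_nonneg hμ_le (h i)
  exact Tuple.unique_antitone (τ := 1) (antitone_of_mem_dilatedAlcove hlam) hμ

end Uniqueness

section Conjugation

variable {ℓ : ℕ}

theorem antiTranspose_cochar_mul_cochar (lam : Fin ℓ → ℤ) {z : ℂ} (hz : z ≠ 0) :
    antiTranspose (cochar lam z) * cochar lam z = 1 := by
  rw [cochar, antiTranspose_diagonal, diagonal_mul_diagonal, ← diagonal_one]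
  congr 1
  funext i
  have hi := i.isLt
  have hrev : (i.rev : ℕ) = 2 * ℓ - 1 - i := by rw [Fin.val_rev]; omega
  dsimp only [Function.comp_apply]
  by_cases h : (i : ℕ) < ℓ
  · simp only [hrev, h, dif_pos, dif_neg (show ¬ 2 * ℓ - 1 - (i : ℕ) < ℓ by omega),
      show 2 * ℓ - 1 - (2 * ℓ - 1 - (i : ℕ)) = i by omega, ← zpow_add₀ hz, neg_add_cancel,
      zpow_zero]
  · simp only [hrev, h, dif_neg, dif_pos (show 2 * ℓ - 1 - (i : ℕ) < ℓ by omega),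
      ← zpow_add₀ hz, add_neg_cancel, zpow_zero, not_false_eq_true]

theorem antiTranspose_mul_self_mul {R : Type*} [CommSemiring R] {n : ℕ}
    {M N : Matrix (Fin n) (Fin n) R} (hM : antiTranspose M * M = 1)
    (hN : antiTranspose N * N = 1) : antiTranspose (M * N) * (M * N) = 1 := by
  rw [antiTranspose_mul, mul_assoc, ← mul_assoc _ M, hM, one_mul, hN]

theorem commute_diagonal_permMatrix_swap {R n : Type*} [CommSemiring R] [Fintype n] [DecidableEq n]
    {d : n → R} {x y : n} (h : d x = d y) :
    Commute (diagonal d) ((Equiv.swap x y).permMatrix R) := by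
  have hd (i : n) : d (Equiv.swap x y i) = d i := by
    rw [Equiv.swap_apply_def]
    split_ifs <;> simp_all
  ext i j
  rw [diagonal_mul, mul_diagonal, permMatrix_apply]
  split_ifs with hij
  · rw [one_mul, mul_one, ← hij, hd]
  · rw [zero_mul, mul_zero]

/-- The reflection interchanges the two middle basis vectors, which are fixed by `lam(z)`. -/
theorem exists_reflection_commute_cochar (hl : 0 < ℓ) {lam : Fin ℓ → ℤ}
    (h : lam ⟨ℓ - 1, by omega⟩ = 0) (z : ℂ) : ∃ T : Matrix (Fin (2 * ℓ)) (Fin (2 * ℓ)) ℂ,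
      antiTranspose T * T = 1 ∧ T.det = -1 ∧ Commute (cochar lam z) T := by
  let x : Fin (2 * ℓ) := ⟨ℓ - 1, by omega⟩
  let y : Fin (2 * ℓ) := ⟨ℓ, by omega⟩
  have hxy : x ≠ y := Fin.ne_of_val_ne (by dsimp only [x, y]; omega)
  have hx : Fin.revPerm x = y := by
    ext
    simp only [x, y, Fin.revPerm_apply, Fin.val_rev]
    omega
  have hy : Fin.revPerm y = x := by rw [← hx, Fin.revPerm_apply, Fin.revPerm_apply, Fin.rev_rev]
  have hcomm : Commute Fin.revPerm (Equiv.swap x y) := by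
    rw [commute_iff_eq, Equiv.mul_swap_eq_swap_mul, hx, hy, Equiv.swap_comm]
  refine ⟨(Equiv.swap x y).permMatrix ℂ, ?_, ?_, ?_⟩
  · rw [antiTranspose_permMatrix hcomm, ← permMatrix_mul, mul_inv_cancel, permMatrix_one]
  · rw [det_permutation, Equiv.Perm.sign_swap hxy]
    simp
  · rw [cochar]
    refine commute_diagonal_permMatrix_swap ?_
    simp only [x, y, dif_pos (show ℓ - 1 < ℓ by omega), dif_neg (lt_irrefl ℓ),
      show 2 * ℓ - 1 - ℓ = ℓ - 1 by omega, h, neg_zero]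

theorem exists_mem_SO_mul_eq_mul_cochar (hl : 0 < ℓ) {g h : Matrix (Fin (2 * ℓ)) (Fin (2 * ℓ)) ℂ}
    {lam : Fin ℓ → ℤ} (hlam : lam ⟨ℓ - 1, by omega⟩ = 0) {z : ℂ} (hh : antiTranspose h * h = 1)
    (hgh : g * h = h * cochar lam z) : ∃ k ∈ SO ℓ, g * k = k * cochar lam z := by
  have hdet : h.det = 1 ∨ h.det = -1 := by
    rw [← mul_self_eq_one_iff, ← det_one (n := Fin (2 * ℓ)), ← hh, det_mul, det_antiTranspose]
  rcases hdet with hdet | hdet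
  · exact ⟨h, mem_SO_iff.2 ⟨hh, hdet⟩, hgh⟩
  · obtain ⟨T, hT, hTdet, hTcomm⟩ := exists_reflection_commute_cochar hl hlam z
    refine ⟨h * T, mem_SO_iff.2 ⟨antiTranspose_mul_self_mul hh hT, ?_⟩, ?_⟩
    · rw [det_mul, hdet, hTdet, neg_mul_neg, one_mul]
    · rw [← mul_assoc, hgh, mul_assoc, hTcomm.eq, mul_assoc]

theorem exists_mem_SO_conj_eq_cochar (hl : 0 < ℓ) {g : Matrix (Fin (2 * ℓ)) (Fin (2 * ℓ)) ℂ}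
    (hg : g ∈ SO ℓ) (hfin : IsOfFinOrder g) {lam : Fin ℓ → ℤ} (hlam : lam ⟨ℓ - 1, by omega⟩ = 0)
    {z : ℂ} (hz : z ≠ 0) (hchar : g.charpoly = (cochar lam z).charpoly) :
    ∃ h ∈ SO ℓ, h⁻¹ * g * h = cochar lam z := by
  have hsemisimple := isSemisimple_toLin'_of_pow_eq_one
    (Nat.cast_ne_zero.2 hfin.orderOf_pos.ne') (pow_orderOf_eq_one g)
  obtain ⟨P, hP, hgP⟩ := exists_mul_eq_mul_diagonal_of_charpoly_eq hsemisimple hchar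
  obtain ⟨k, hk, hgk⟩ := exists_unitary_conj_of_conj two_ne_zero antiTranspose_mul
    antiTranspose_antiTranspose (mem_SO_iff.1 hg).1
    (mul_eq_one_comm.1 (antiTranspose_cochar_mul_cochar lam hz)) hP hgP
  obtain ⟨h, hh, hgh⟩ := exists_mem_SO_mul_eq_mul_cochar hl hlam hk hgk
  have hunit : IsUnit h.det := (mem_SO_iff.1 hh).2 ▸ isUnit_one
  exact ⟨h, hh, by rw [mul_assoc, hgh, nonsing_inv_mul_cancel_left _ _ hunit]⟩

end Conjugation

section KacDiagram

variable {ℓ : ℕ}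

theorem isKacDiagram_iff (hl : 4 ≤ ℓ) {g : Matrix (Fin (2 * ℓ)) (Fin (2 * ℓ)) ℂ} (hg : g ∈ SO ℓ)
    (hfin : IsOfFinOrder g) {ξ : ℂ} (hξ : IsPrimitiveRoot ξ (orderOf g)) {μ : Fin ℓ → ℤ}
    (hchar : g.charpoly = (cochar μ ξ).charpoly) (hμ : Antitone μ)
    (hlast : μ ⟨ℓ - 1, by omega⟩ = 0) (hfirst : 2 * μ ⟨0, by omega⟩ = orderOf g)
    {d : Fin (ℓ + 1) → ℤ} :
    IsKacDiagram ξ g d ↔ d = reduce (kacLabels (by omega) (orderOf g) μ) := by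
  have hm := hfin.orderOf_pos
  rw [isKacDiagram_iff_exists_cochar hl]
  constructor
  · rintro ⟨-, -, -, h, hh, lam, hconj, hlam, rfl⟩
    have hunit : IsUnit h := (isUnit_iff_isUnit_det h).2 ((mem_SO_iff.1 hh).2 ▸ isUnit_one)
    have hgh : g * h = h * cochar lam ξ := by
      rw [← hconj, mul_assoc, mul_nonsing_inv_cancel_left _ _ ((isUnit_iff_isUnit_det h).1 hunit)]
    obtain ⟨τ, hτ⟩ := exists_perm_of_charpoly_cochar_eq hξ hm.ne'
      ((charpoly_eq_of_mul_eq_mul hunit hgh).symm.trans hchar)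
    rw [eq_of_mem_dilatedAlcove (by omega) (Nat.cast_pos.2 hm) hlam hμ hlast hfirst hτ]
  · rintro rfl
    have hbound := mem_dilatedAlcove_of_antitone hμ
      (nonneg_and_two_mul_le_of_antitone (by omega) hμ hlast hfirst)
    obtain ⟨h, hh, hconj⟩ := exists_mem_SO_conj_eq_cochar (by omega) hg hfin hlast
      (hξ.ne_zero hm.ne') hchar
    exact ⟨hg, hfin, hξ, h, hh, μ, hconj, hbound, rfl⟩

theorem kacLabels_sigmaVec (hl : 2 ≤ ℓ) (p : Nat.Partition ℓ) :
    kacLabels hl (mOf p) (sigmaVec p) = sigmaLabels p := by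
  funext k
  induction k using Fin.cases with
  | zero => rfl
  | succ k =>
    have hk := k.isLt
    rw [kacLabels, Fin.cons_succ, sigmaLabels, Fin.val_succ, if_neg (Nat.succ_ne_zero _)]
    split_ifs
    · rfl
    · simp only [sigmaVec, Nat.sub_add_cancel (show 1 ≤ (k : ℕ) by omega)]
      rw [show (k : ℕ) + 1 = ℓ by omega, show (k : ℕ) = ℓ - 1 by omega]

end KacDiagram

end KacD

/-- The Kac diagram of the element `n` of `SO_{2ℓ}` attached to a partition of `ℓ ≥ 4` with an even
number of parts. -/
theorem mainTheorem7 (ℓ : ℕ) (hl : 4 ≤ ℓ) (p : Nat.Partition ℓ) (hp : Even p.parts.card) :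
    KacD.nMat p ∈ KacD.SO ℓ ∧ IsOfFinOrder (KacD.nMat p) ∧
    ∀ ξ : ℂ, IsPrimitiveRoot ξ (orderOf (KacD.nMat p)) →
      ∀ d : Fin (ℓ + 1) → ℤ,
        KacD.IsKacDiagram ξ (KacD.nMat p) d ↔ d = KacD.reduce (KacD.sigmaLabels p) := by
  have hmem : KacD.nMat p ∈ KacD.SO ℓ := KacD.nMat_mem_SO p hp
  have horder : orderOf (KacD.nMat p) = KacD.mOf p := KacD.orderOf_nMat p (by omega)
  have hfin : IsOfFinOrder (KacD.nMat p) := orderOf_pos_iff.1 (horder ▸ KacD.mOf_pos p)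
  refine ⟨hmem, hfin, fun ξ hξ d => ?_⟩
  have hchar : (KacD.nMat p).charpoly = (KacD.cochar (KacD.sigmaVec p) ξ).charpoly :=
    KacD.charpoly_nMat_eq_charpoly_cochar hp (horder ▸ hξ)
  rw [KacD.isKacDiagram_iff hl hmem hfin hξ hchar KacD.sigmaVec_antitone
    (KacD.sigmaVec_last (by omega) hp) (by rw [KacD.two_mul_sigmaVec_zero (by omega) hp, horder]),
    horder, KacD.kacLabels_sigmaVec]
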